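/- Let $q\ge 2$ be a fixed integer. An arithmetic formula in the variables $x_1,\dots,x_n$ is a finite directed acyclic graph consisting of $+$ gates of unbounded fan-in, $\times$ gates of fan-in two, and terminal nodes, which are the variables (there are no constants and no subtractions), in which every gate has fan-out at most one, while a terminal node may feed several gates; a terminal node is joined to a $+$ gate by at most one edge, but may be both inputs of a $\times$ gate. Its size $s$ is the number of its $+$ and $\times$ gates (read as $1$ if the formula is a single variable). Such a formula computes a polynomial $F(x_1,\dots,x_n)$ with integer coefficients, whose sum-product expansion is its expansion into monomials. A monomial $x_{i_1}^{s_1}\cdots x_{i_t}^{s_t}$, with $x_{i_1},\dots,x_{i_t}$ the distinct variables that occur in it, is called a $q$-monomial if $1\le s_j\le q-1$ for all $j$; its degree is $s_1+\cdots+s_t$. There is a deterministic algorithm (a single random access program, charged at logarithmic cost) which, given $n$, an integer $k\ge 0$ and an arithmetic formula of size $s$ in $n$ variables, decides whether the sum-product expansion of the polynomial $F$ computed by the formula contains a $q$-monomial of degree $k$, and which runs in time $O^*(5.44^k s^4)$, where $O^*$ suppresses factors polynomial in $n$ and $k$; that is, there are constants $C,c$ depending only on $q$ such that the running time is at most $C\,(n+k+1)^c\cdot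 5.44^k\cdot s^4$ for all $n$, $k$ and all formulas. -/

import Mathlib

namespace QMonomial

/-! ### Arithmetic formulas -/

/-- Arithmetic formulas in `n` variables: terminal nodes are variables, `+` gates have unbounded
fan-in and `×` gates have fan-in two. As every gate has fan-out at most one, the gates form a tree;
a terminal node may feed several gates, so it is repeated wherever it is used. -/
inductive Formula (n : ℕ) : Type where
  | var (i : Fin n) : Formula n
  | add (l : List (Formula n)) : Formula n
  | mul (a b : Formula n) : Formula n

namespace Formula

variable {n : ℕ}

/-- The size of a formula: the number of its gates (terminal nodes are not gates). -/
def size : Formula n → ℕ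
  | var _ => 0
  | add l => 1 + (l.map fun φ => φ.size).sum
  | mul a b => 1 + a.size + b.size

/-- The variable of a terminal node; gates have none. -/
def terminal? : Formula n → Option (Fin n)
  | var i => some i
  | _ => none

/-- The underlying graph has no parallel edges into a `+` gate: a terminal node is connected to
a `+` gate by at most one edge. (Without this the number of gates would not bound the length of
the formula.) A `×` gate may take the same terminal node as both of its inputs. -/
def IsSimple : Formula n → Prop
  | var _ => True
  | add l => (l.filterMap terminal?).Nodup ∧ ∀ φ ∈ l, φ.IsSimple
  | mul a b => a.IsSimple ∧ b.IsSimple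

/-- The polynomial computed by a formula; its support is the set of monomials of the sum-product
expansion. -/
noncomputable def toPoly : Formula n → MvPolynomial (Fin n) ℤ
  | var i => MvPolynomial.X i
  | add l => (l.map fun φ => φ.toPoly).sum
  | mul a b => a.toPoly * b.toPoly

/-- A formula written in postfix notation, two numbers per node: the kind of the node
(`0` variable, `1` sum, `2` product), followed by the index of the variable or the fan-in. -/
def encode : Formula n → List ℕ
  | var i => [0, (i : ℕ)]
  | add l => (l.map fun φ => φ.encode).flatten ++ [1, l.length]
  | mul a b => a.encode ++ b.encode ++ [2, 2]

end Formula

/-! ### `q`-monomials -/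

/-- `x^m` is a `q`-monomial: every variable that occurs in it has exponent between `1` and
`q - 1`. -/
def IsQMonomial {n : ℕ} (q : ℕ) (m : Fin n →₀ ℕ) : Prop :=
  ∀ i ∈ m.support, 1 ≤ m i ∧ m i ≤ q - 1

/-- The sum-product expansion of `F` contains a `q`-monomial of degree `k`. -/
def HasQMonomial {n : ℕ} (q k : ℕ) (F : MvPolynomial (Fin n) ℤ) : Prop :=
  ∃ m ∈ F.support, IsQMonomial q m ∧ m.degree = k

/-! ### Deterministic random access programs with logarithmic (bit) cost -/

/-- The memory: registers and one-dimensional arrays holding natural numbers. A program names only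
finitely many registers and arrays, but the arrays are unbounded. -/
structure Memory where
  reg : ℕ → ℕ
  arr : ℕ → ℕ → ℕ

/-- Write `v` into register `x`. -/
def Memory.setReg (σ : Memory) (x v : ℕ) : Memory where
  reg := Function.update σ.reg x v
  arr := σ.arr

/-- Write `v` into cell `i` of array `a`. -/
def Memory.setArr (σ : Memory) (a i v : ℕ) : Memory where
  reg := σ.reg
  arr := Function.update σ.arr a (Function.update (σ.arr a) i v)

/-- Expressions. Subtraction is truncated, division is rounded down and `v / 0 = 0`. -/
inductive Expr : Type where
  | const (c : ℕ) : Expr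
  | reg (x : ℕ) : Expr
  | load (a : ℕ) (i : Expr) : Expr
  | add (e f : Expr) : Expr
  | sub (e f : Expr) : Expr
  | mul (e f : Expr) : Expr
  | div (e f : Expr) : Expr

/-- The cost of handling the number `v`: its binary length plus one. -/
def bits (v : ℕ) : ℕ := Nat.size v + 1

/-- The value of an expression. -/
def Expr.eval (σ : Memory) : Expr → ℕ
  | const c => c
  | reg x => σ.reg x
  | load a i => σ.arr a (i.eval σ)
  | add e f => e.eval σ + f.eval σ
  | sub e f => e.eval σ - f.eval σ
  | mul e f => e.eval σ * f.eval σ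
  | div e f => e.eval σ / f.eval σ

/-- The time to evaluate an expression: addition, subtraction and memory access are charged
linearly in the binary lengths of the numbers (and addresses) involved, multiplication and
division by the product of these lengths. -/
def Expr.cost (σ : Memory) : Expr → ℕ
  | const c => bits c
  | reg x => bits (σ.reg x)
  | load a i => i.cost σ + bits (i.eval σ) + bits (σ.arr a (i.eval σ))
  | add e f => e.cost σ + f.cost σ + bits (e.eval σ) + bits (f.eval σ)
  | sub e f => e.cost σ + f.cost σ + bits (e.eval σ) + bits (f.eval σ)
  | mul e f => e.cost σ + f.cost σ + bits (e.eval σ) * bits (f.eval σ)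
  | div e f => e.cost σ + f.cost σ + bits (e.eval σ) * bits (f.eval σ)

/-- Programs. `cond e P Q` runs `P` if `e ≠ 0` and `Q` otherwise; `loop e P` repeats `P` while
`e ≠ 0`. -/
inductive Program : Type where
  | skip : Program
  | assign (x : ℕ) (e : Expr) : Program
  | store (a : ℕ) (i e : Expr) : Program
  | seq (P Q : Program) : Program
  | cond (e : Expr) (P Q : Program) : Program
  | loop (e : Expr) (P : Program) : Program

/-- `Exec P σ τ t`: the program `P`, started in memory `σ`, halts in memory `τ` after time `t`. -/
inductive Exec : Program → Memory → Memory → ℕ → Prop where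
  | skip (σ : Memory) : Exec .skip σ σ 1
  | assign (x : ℕ) (e : Expr) (σ : Memory) :
      Exec (.assign x e) σ
        (σ.setReg x (e.eval σ))
        (e.cost σ + bits (e.eval σ) + 1)
  | store (a : ℕ) (i e : Expr) (σ : Memory) :
      Exec (.store a i e) σ
        (σ.setArr a (i.eval σ) (e.eval σ))
        (i.cost σ + e.cost σ + bits (i.eval σ) + bits (e.eval σ) + 1)
  | seq {P Q : Program} {σ τ ρ : Memory} {t u : ℕ} :
      Exec P σ τ t → Exec Q τ ρ u → Exec (.seq P Q) σ ρ (t + u)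
  | cond_true {e : Expr} {P Q : Program} {σ τ : Memory} {t : ℕ} :
      e.eval σ ≠ 0 → Exec P σ τ t → Exec (.cond e P Q) σ τ (e.cost σ + 1 + t)
  | cond_false {e : Expr} {P Q : Program} {σ τ : Memory} {t : ℕ} :
      e.eval σ = 0 → Exec Q σ τ t → Exec (.cond e P Q) σ τ (e.cost σ + 1 + t)
  | loop_stop {e : Expr} {P : Program} {σ : Memory} :
      e.eval σ = 0 → Exec (.loop e P) σ σ (e.cost σ + 1)
  | loop_step {e : Expr} {P : Program} {σ τ ρ : Memory} {t u : ℕ} :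
      e.eval σ ≠ 0 → Exec P σ τ t → Exec (.loop e P) τ ρ u →
        Exec (.loop e P) σ ρ (e.cost σ + 1 + t + u)

/-- The initial memory on input `(n, k, φ)`: registers `0`, `1`, `2` hold `n`, `k` and the length of
the encoding of `φ`, array `0` holds this encoding, and everything else is zero. -/
def input {n : ℕ} (k : ℕ) (φ : Formula n) : Memory where
  reg := fun x => if x = 0 then n else if x = 1 then k else if x = 2 then φ.encode.length else 0
  arr := fun a i => if a = 0 then φ.encode.getD i 0 else 0

end QMonomial

/-!
Give every variable `x_i` the copies `i * r + j`, `j < r = q - 1`, and replace `x_i` by the sum of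
its copies. A monomial of degree `k` yields a product of `k` distinct copies if and only if it is
a `q`-monomial. Let the copy `a` act on `Λ(ℤ^k) ⊗ Λ(ℤ^k)` as exterior multiplication by `v_a ⊗ v_a`,
where `v_a = (1, 2^a, 2^(2a), …)`. Products of length other than `k` have no top coefficient, and
the top coefficient of a product of `k` copies is the square of a Vandermonde determinant: it is
nonnegative, and positive if and only if the copies are distinct. So nothing cancels, and the
formula contains a `q`-monomial of degree `k` if and only if its value in this algebra of dimension
`4 ^ k` has a nonzero top coefficient. The formula is not evaluated by multiplying elements of the
algebra: it acts on a vector as a series-parallel network, so that each leaf is applied once to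
a vector, in time `4 ^ k` up to polynomial factors.
-/

namespace QMonomial

/-! ### Binary digits -/

/-- Bit `s` of the mask `S` is zero. -/
abbrev IsClear (S s : ℕ) : Prop := S / 2 ^ s % 2 = 0

/-- The number of ones in the binary expansion. It determines the signs of exterior products. -/
def popCount (m : ℕ) : ℕ := (Nat.digits 2 m).sum

theorem popCount_zero : popCount 0 = 0 := by simp [popCount]

theorem popCount_eq (m : ℕ) : popCount m = popCount (m / 2) + m % 2 := by
  rcases eq_or_ne m 0 with rfl | h
  · simp [popCount]
  · rw [popCount, Nat.digits_eq_cons_digits_div one_lt_two h, List.sum_cons, add_comm, popCount]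

theorem popCount_le (m : ℕ) : popCount m ≤ m := Nat.digit_sum_le 2 m

theorem popCount_add_two_pow {m d : ℕ} (h : IsClear m d) :
    popCount (m + 2 ^ d) = popCount m + 1 := by
  induction d generalizing m with
  | zero =>
    rw [IsClear, pow_zero, Nat.div_one] at h
    rw [popCount_eq (m + 2 ^ 0), popCount_eq m, pow_zero, show (m + 1) / 2 = m / 2 by omega]
    omega
  | succ d ih =>
    have hhalf : IsClear (m / 2) d := by rwa [IsClear, Nat.div_div_eq_div_mul, ← pow_succ']
    rw [popCount_eq (m + 2 ^ (d + 1)), popCount_eq m, pow_succ,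
      Nat.add_mul_div_right _ _ two_pos, ih hhalf, Nat.add_mul_mod_self_right]
    omega

theorem popCount_two_pow_sub_one (k : ℕ) : popCount (2 ^ k - 1) = k := by
  induction k with
  | zero => exact popCount_zero
  | succ k ih =>
    have hpos : 0 < 2 ^ k := by positivity
    rw [show 2 ^ (k + 1) - 1 = (2 ^ k - 1) + 2 ^ k by rw [pow_succ]; omega,
      popCount_add_two_pow (by rw [IsClear, Nat.div_eq_of_lt (by omega)]), ih]

theorem add_two_pow_div_of_lt {S s t : ℕ} (h : IsClear S s) (hst : s < t) :
    (S + 2 ^ s) / 2 ^ t = S / 2 ^ t := by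
  obtain ⟨d, rfl⟩ := Nat.exists_eq_add_of_lt hst
  rw [add_assoc, pow_add, ← Nat.div_div_eq_div_mul, ← Nat.div_div_eq_div_mul,
    Nat.add_div_right _ (by positivity), pow_succ', ← Nat.div_div_eq_div_mul,
    ← Nat.div_div_eq_div_mul]
  congr 1
  omega

theorem add_two_pow_div_of_gt {S s t : ℕ} (hst : t < s) :
    (S + 2 ^ s) / 2 ^ t = S / 2 ^ t + 2 ^ (s - t) := by
  conv_lhs => rw [← Nat.add_sub_cancel' hst.le, pow_add, Nat.add_mul_div_left _ _ (by positivity)]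

theorem isClear_add_two_pow_iff {S s t : ℕ} (h : IsClear S s) (hst : s ≠ t) :
    IsClear (S + 2 ^ s) t ↔ IsClear S t := by
  unfold IsClear
  rcases lt_or_gt_of_ne hst with hlt | hgt
  · rw [add_two_pow_div_of_lt h hlt]
  · obtain ⟨d, hd⟩ := Nat.exists_eq_add_of_lt hgt
    rw [add_two_pow_div_of_gt hgt, show s - t = d + 1 by omega, pow_succ,
      Nat.add_mul_mod_self_right]

theorem not_isClear_add_two_pow {S s : ℕ} (h : IsClear S s) : ¬ IsClear (S + 2 ^ s) s := by
  unfold IsClear at h ⊢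
  rw [Nat.add_div_right _ (by positivity)]
  omega

theorem add_two_pow_lt {S s k : ℕ} (h : IsClear S s) (hs : s < k) (hS : S < 2 ^ k) :
    S + 2 ^ s < 2 ^ k := by
  have hdiv := add_two_pow_div_of_lt h hs
  rw [Nat.div_eq_of_lt hS] at hdiv
  exact (Nat.div_eq_zero_iff.1 hdiv).resolve_left (by positivity)

theorem popCount_add_two_pow_div {S s t : ℕ} (hst : s < t) (ht : IsClear S t) :
    popCount ((S + 2 ^ t) / 2 ^ s) = popCount (S / 2 ^ s) + 1 := by
  rw [add_two_pow_div_of_gt hst, popCount_add_two_pow]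
  rwa [IsClear, Nat.div_div_eq_div_mul, ← pow_add, Nat.add_sub_cancel' hst.le]

/-! ### Creation operators and determinants -/

section Creation

variable {R : Type*} [CommRing R]

/-- The creation operator of the basis vector `e_s`: exterior multiplication by `e_s`, dualized, so
that it acts on functions of the masks `S` that index the standard basis of the exterior algebra. -/
def raise (R : Type*) [CommRing R] (s : ℕ) : Module.End R (ℕ → R) where
  toFun ψ S := if IsClear S s then (-1) ^ popCount (S / 2 ^ s) * ψ (S + 2 ^ s) else 0
  map_add' ψ χ := by
    funext S
    simp only [Pi.add_apply]
    split_ifs <;> ring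
  map_smul' c ψ := by
    funext S
    simp only [Pi.smul_apply, smul_eq_mul, RingHom.id_apply]
    split_ifs <;> ring

theorem raise_apply (s : ℕ) (ψ : ℕ → R) (S : ℕ) : raise R s ψ S =
    if IsClear S s then (-1) ^ popCount (S / 2 ^ s) * ψ (S + 2 ^ s) else 0 := rfl

theorem raise_mul_self (s : ℕ) : raise R s * raise R s = 0 := by
  ext ψ S
  rw [Module.End.mul_apply, raise_apply]
  split_ifs with h
  · rw [raise_apply, if_neg (not_isClear_add_two_pow h), mul_zero]
    rfl
  · rfl

theorem raise_mul_raise_of_lt {s t : ℕ} (hst : s < t) :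
    raise R s * raise R t = -(raise R t * raise R s) := by
  ext ψ S
  simp only [Module.End.mul_apply, LinearMap.neg_apply, Pi.neg_apply, raise_apply]
  by_cases hs : IsClear S s
  · by_cases ht : IsClear S t
    · rw [if_pos hs, if_pos ((isClear_add_two_pow_iff hs hst.ne).2 ht), if_pos ht,
        if_pos ((isClear_add_two_pow_iff ht hst.ne').2 hs), add_two_pow_div_of_lt hs hst,
        popCount_add_two_pow_div hst ht, add_right_comm S]
      ring
    · rw [if_pos hs, if_neg (mt (isClear_add_two_pow_iff hs hst.ne).1 ht), if_neg ht]
      ring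
  · rw [if_neg hs]
    split_ifs with ht h
    · exact absurd ((isClear_add_two_pow_iff ht hst.ne').1 h) hs
    · ring
    · ring

theorem raise_mul_raise_add_swap (s t : ℕ) : raise R s * raise R t + raise R t * raise R s = 0 := by
  rcases lt_trichotomy s t with h | rfl | h
  · rw [raise_mul_raise_of_lt h, neg_add_cancel]
  · rw [raise_mul_self, add_zero]
  · rw [raise_mul_raise_of_lt h, add_neg_cancel]

/-- Multiplication by a vector of `R ^ k` in the exterior algebra, dualized as in `raise`. -/
def creation (R : Type*) [CommRing R] (k : ℕ) : (Fin k → R) →ₗ[R] Module.End R (ℕ → R) :=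
  Fintype.linearCombination R fun s : Fin k => raise R s

theorem creation_eq_sum {k : ℕ} (v : Fin k → R) :
    creation R k v = ∑ s : Fin k, v s • raise R s := rfl

theorem creation_single {k : ℕ} (s : Fin k) : creation R k (Pi.single s 1) = raise R s := by
  rw [creation, Fintype.linearCombination_apply_single, one_smul]

theorem creation_mul_self {k : ℕ} (v : Fin k → R) : creation R k v * creation R k v = 0 := by
  rw [creation_eq_sum, Finset.sum_mul_sum, ← Finset.sum_product']
  refine Finset.sum_involution (fun p _ => p.swap) (fun p _ => ?_) (fun p _ hp hswap => hp ?_)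
    (fun _ _ => Finset.mem_univ _) fun p _ => p.swap_swap
  · simp only [Prod.fst_swap, Prod.snd_swap, smul_mul_smul_comm, mul_comm (v p.2), ← smul_add,
      raise_mul_raise_add_swap, smul_zero]
  · have hfst : p.2 = p.1 := congrArg Prod.fst hswap
    rw [hfst, smul_mul_smul_comm, raise_mul_self, smul_zero]

/-- The indicator of the full mask; as a functional it reads off the top coefficient. -/
def fullMask (R : Type*) [CommRing R] (k S : ℕ) : R := if S = 2 ^ k - 1 then 1 else 0

theorem prod_raise_apply_zero (ψ : ℕ → R) (m : ℕ) :
    ((List.range m).map (raise R)).prod ψ 0 = ψ (2 ^ m - 1) := by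
  induction m generalizing ψ with
  | zero => rfl
  | succ m ih =>
    have hpos : 0 < 2 ^ m := by positivity
    have hclear : (2 ^ m - 1) / 2 ^ m = 0 := Nat.div_eq_of_lt (by omega)
    rw [List.range_succ, List.map_append, List.prod_append, List.map_singleton,
      List.prod_singleton, Module.End.mul_apply, ih, raise_apply, if_pos (by rw [IsClear, hclear]),
      hclear, popCount_zero, pow_zero, one_mul, show 2 ^ m - 1 + 2 ^ m = 2 ^ (m + 1) - 1 by omega]

/-- The top coefficient of a product of `k` vectors, as an alternating form. -/
noncomputable def topForm (R : Type*) [CommRing R] (k : ℕ) : (Fin k → R) [⋀^Fin k]→ₗ[R] R :=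
  ((LinearMap.proj (0 : ℕ) ∘ₗ LinearMap.applyₗ (fullMask R k)) ∘ₗ
    (ExteriorAlgebra.lift R ⟨creation R k, creation_mul_self⟩).toLinearMap).compAlternatingMap
      (ExteriorAlgebra.ιMulti R k)

theorem topForm_apply {k : ℕ} (v : Fin k → Fin k → R) :
    topForm R k v = (List.ofFn fun i => creation R k (v i)).prod (fullMask R k) 0 := by
  simp only [topForm, LinearMap.compAlternatingMap_apply, LinearMap.comp_apply,
    ExteriorAlgebra.ιMulti_apply, AlgHom.toLinearMap_apply, map_list_prod, List.map_ofFn,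
    Function.comp_def, ExteriorAlgebra.lift_ι_apply, LinearMap.applyₗ_apply_apply,
    LinearMap.proj_apply]

theorem topForm_basisFun (k : ℕ) : topForm R k (Pi.basisFun R (Fin k)) = 1 := by
  have hraise : (List.ofFn fun i : Fin k => creation R k (Pi.basisFun R (Fin k) i)) =
      (List.range k).map (raise R) := by
    simp only [Pi.basisFun_apply, creation_single, List.ofFn_eq_map,
      ← List.map_coe_finRange_eq_range, List.map_map, Function.comp_def]
  rw [topForm_apply, hraise, prod_raise_apply_zero, fullMask, if_pos rfl]

theorem prod_creation_eq_det {k : ℕ} (v : Fin k → Fin k → R) :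
    (List.ofFn fun i => creation R k (v i)).prod (fullMask R k) 0 = (Matrix.of v).det := by
  rw [← topForm_apply, (topForm R k).eq_smul_basis_det (Pi.basisFun R (Fin k)), topForm_basisFun,
    one_smul, Pi.basisFun_det_apply]

end Creation

/-- Exterior multiplication by the Vandermonde vector with node `2 ^ a`. -/
def vandermondeCreation (k a : ℕ) : Module.End ℤ (ℕ → ℤ) :=
  creation ℤ k fun s => ((2 : ℤ) ^ a) ^ (s : ℕ)

theorem vandermondeCreation_apply (k a : ℕ) (ψ : ℕ → ℤ) (S : ℕ) :
    vandermondeCreation k a ψ S = ∑ s ∈ Finset.range k, if IsClear S s then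
      (-1) ^ popCount (S / 2 ^ s) * 2 ^ (a * s) * ψ (S + 2 ^ s) else 0 := by
  rw [vandermondeCreation, creation_eq_sum, LinearMap.sum_apply, Finset.sum_apply,
    Finset.sum_range]
  refine Finset.sum_congr rfl fun s _ => ?_
  rw [LinearMap.smul_apply, Pi.smul_apply, raise_apply, smul_eq_mul, ← pow_mul]
  split_ifs <;> ring

/-- The coefficients of the exterior product of the Vandermonde vectors with nodes `2 ^ a`,
`a ∈ α`; the one at the empty mask is the top coefficient, because the operators are dualized. -/
def extProd (k : ℕ) (α : List ℕ) : ℕ → ℤ := (α.map (vandermondeCreation k)).prod (fullMask ℤ k)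

theorem extProd_cons (k a : ℕ) (α : List ℕ) :
    extProd k (a :: α) = vandermondeCreation k a (extProd k α) := by
  rw [extProd, List.map_cons, List.prod_cons]
  rfl

theorem popCount_add_length_of_extProd_ne_zero {k : ℕ} {α : List ℕ} {S : ℕ}
    (h : extProd k α S ≠ 0) : popCount S + α.length = k := by
  induction α generalizing S with
  | nil =>
    have hS : S = 2 ^ k - 1 := of_not_not fun hS => h (if_neg hS)
    rw [hS, popCount_two_pow_sub_one, List.length_nil, add_zero]
  | cons a α ih =>
    rw [extProd_cons, vandermondeCreation_apply] at h
    obtain ⟨s, -, hs⟩ := Finset.exists_ne_zero_of_sum_ne_zero h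
    have hclear : IsClear S s := of_not_not fun hS => hs (if_neg hS)
    rw [if_pos hclear] at hs
    have hlen := ih (right_ne_zero_of_mul hs)
    rw [popCount_add_two_pow hclear] at hlen
    rw [List.length_cons]
    omega

theorem extProd_length_apply_zero (α : List ℕ) : extProd α.length α 0 =
    (Matrix.vandermonde fun i : Fin α.length => (2 : ℤ) ^ α.get i).det := by
  rw [show Matrix.vandermonde (fun i : Fin α.length => (2 : ℤ) ^ α.get i) =
    Matrix.of fun i (s : Fin α.length) => ((2 : ℤ) ^ α.get i) ^ (s : ℕ) from rfl,
    ← prod_creation_eq_det, extProd]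
  conv_lhs => enter [1, 1, 2]; rw [← List.ofFn_get α]
  rw [List.map_ofFn]
  rfl

theorem extProd_apply_zero_ne_zero_iff (k : ℕ) (α : List ℕ) :
    extProd k α 0 ≠ 0 ↔ α.length = k ∧ α.Nodup := by
  refine ⟨fun h => ?_, ?_⟩
  · have hlen : α.length = k := by
      rw [← popCount_add_length_of_extProd_ne_zero h, popCount_zero, zero_add]
    subst hlen
    rw [extProd_length_apply_zero, Matrix.det_vandermonde_ne_zero_iff] at h
    exact ⟨rfl, List.nodup_iff_injective_get.2 fun i j hij => h (congrArg (2 ^ ·) hij)⟩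
  · rintro ⟨rfl, hα⟩
    rw [extProd_length_apply_zero, Matrix.det_vandermonde_ne_zero_iff]
    exact (Int.pow_right_injective (by norm_num)).comp (List.nodup_iff_injective_get.1 hα)

/-! ### Words of a formula -/

theorem sum_map_pos_iff {ι M : Type*} [AddCommMonoid M] [PartialOrder M] [IsOrderedAddMonoid M]
    {f : ι → M} (hf : ∀ x, 0 ≤ f x) (l : List ι) :
    0 < (l.map f).sum ↔ ∃ x ∈ l, 0 < f x := by
  have hnonneg : ∀ y ∈ l.map f, 0 ≤ y := List.forall_mem_map.2 fun x _ => hf x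
  constructor
  · intro h
    by_contra! hzero
    refine h.ne' (List.sum_eq_zero (List.forall_mem_map.2 fun x hx => ?_))
    exact of_not_not fun hne => hzero x hx ((hf x).lt_of_ne' hne)
  · rintro ⟨x, hx, hpos⟩
    exact hpos.trans_le (List.single_le_sum hnonneg _ (List.mem_map_of_mem hx))

namespace Formula

variable {n : ℕ}

theorem induction {P : Formula n → Prop} (var : ∀ i, P (var i))
    (add : ∀ l, (∀ φ ∈ l, P φ) → P (add l)) (mul : ∀ a b, P a → P b → P (mul a b)) (φ : Formula n) :
    P φ := by
  refine Formula.rec (motive_1 := P) (motive_2 := fun l => ∀ φ ∈ l, P φ) var add mul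
    (fun φ h => absurd h List.not_mem_nil) (fun ψ l hψ hl φ hφ => ?_) φ
  rcases List.mem_cons.1 hφ with rfl | h
  exacts [hψ, hl φ h]

/-- The sum-product expansion, before commuting variables. -/
def words : Formula n → List (List (Fin n))
  | var i => [[i]]
  | add l => (l.map fun φ => φ.words).flatten
  | mul a b => a.words.flatMap fun x => b.words.map fun y => x ++ y

/-- The value of a formula in a semiring that need not be commutative. -/
def evalIn {R : Type*} [Semiring R] (g : Fin n → R) : Formula n → R
  | var i => g i
  | add l => (l.map fun φ => φ.evalIn g).sum
  | mul a b => a.evalIn g * b.evalIn g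

theorem evalIn_eq_sum_words {R : Type*} [Semiring R] (g : Fin n → R) (φ : Formula n) :
    φ.evalIn g = (φ.words.map fun w => (w.map g).prod).sum := by
  induction φ using Formula.induction with
  | var i => simp [evalIn, words]
  | add l ih =>
    simp only [evalIn, words, List.map_flatten, List.sum_flatten, List.map_map, Function.comp_def]
    rw [List.map_congr_left ih]
  | mul a b iha ihb =>
    rw [evalIn, words, iha, ihb, ← List.sum_map_mul_right, List.map_flatMap, List.flatMap_def,
      List.sum_flatten, List.map_map]
    simp only [Function.comp_def, List.map_map, List.map_append, List.prod_append,
      List.sum_map_mul_left]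

theorem toPoly_eq_evalIn (φ : Formula n) : φ.toPoly = φ.evalIn MvPolynomial.X := by
  induction φ using Formula.induction with
  | var i => rw [toPoly, evalIn]
  | add l ih => rw [toPoly, evalIn, List.map_congr_left ih]
  | mul a b iha ihb => rw [toPoly, evalIn, iha, ihb]

end Formula

/-- The exponents of the monomial obtained from a word by commuting its letters. -/
noncomputable def exponents {ι : Type*} (w : List ι) : ι →₀ ℕ :=
  (w.map fun i => Finsupp.single i 1).sum

section Exponents

variable {ι : Type*}

theorem exponents_cons (i : ι) (w : List ι) :
    exponents (i :: w) = Finsupp.single i 1 + exponents w := by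
  rw [exponents, List.map_cons, List.sum_cons, exponents]

theorem prod_map_X {R : Type*} [CommSemiring R] (w : List ι) :
    (w.map (MvPolynomial.X : ι → MvPolynomial ι R)).prod =
      MvPolynomial.monomial (exponents w) 1 := by
  induction w with
  | nil => rfl
  | cons i w ih =>
    rw [List.map_cons, List.prod_cons, ih, exponents_cons, MvPolynomial.X,
      MvPolynomial.monomial_mul, one_mul]

theorem exponents_apply [DecidableEq ι] (w : List ι) (i : ι) : exponents w i = w.count i := by
  induction w with
  | nil => rfl
  | cons j w ih =>
    rw [exponents_cons, Finsupp.add_apply, ih, List.count_cons, add_comm, Finsupp.single_apply]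
    simp only [beq_iff_eq]

theorem degree_exponents (w : List ι) : (exponents w).degree = w.length := by
  induction w with
  | nil => rfl
  | cons i w ih =>
    rw [exponents_cons, map_add, ih, Finsupp.degree_single, List.length_cons, add_comm]

end Exponents

theorem mem_support_toPoly_iff {n : ℕ} (φ : Formula n) (m : Fin n →₀ ℕ) :
    m ∈ φ.toPoly.support ↔ ∃ w ∈ φ.words, exponents w = m := by
  have hcoeff : φ.toPoly.coeff m =
      (φ.words.map fun w => if exponents w = m then (1 : ℤ) else 0).sum := by
    rw [φ.toPoly_eq_evalIn, φ.evalIn_eq_sum_words, ← MvPolynomial.coeffAddMonoidHom_apply,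
      map_list_sum, List.map_map]
    refine congrArg List.sum (List.map_congr_left fun w _ => ?_)
    rw [Function.comp_apply, prod_map_X, MvPolynomial.coeffAddMonoidHom_apply,
      MvPolynomial.coeff_monomial]
  have hnonneg : ∀ w : List (Fin n), (0 : ℤ) ≤ if exponents w = m then 1 else 0 := fun w => by
    split_ifs <;> norm_num
  have hsum : 0 ≤ φ.toPoly.coeff m :=
    hcoeff ▸ List.sum_nonneg (List.forall_mem_map.2 fun w _ => hnonneg w)
  rw [MvPolynomial.mem_support_iff, ← hsum.lt_iff_ne', hcoeff, sum_map_pos_iff hnonneg]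
  refine exists_congr fun w => and_congr_right fun _ => ?_
  split_ifs with h <;> simp [h]

theorem hasQMonomial_iff_words {n : ℕ} (r k : ℕ) (φ : Formula n) :
    HasQMonomial (r + 1) k φ.toPoly ↔ ∃ w ∈ φ.words, w.length = k ∧ ∀ i, w.count i ≤ r := by
  have hq : ∀ w : List (Fin n), IsQMonomial (r + 1) (exponents w) ↔ ∀ i, w.count i ≤ r := by
    intro w
    simp only [IsQMonomial, Finsupp.mem_support_iff, exponents_apply, Nat.add_sub_cancel]
    exact forall_congr' fun i => by omega
  constructor
  · rintro ⟨m, hm, hmq, hdeg⟩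
    obtain ⟨w, hw, rfl⟩ := (mem_support_toPoly_iff φ m).1 hm
    exact ⟨w, hw, by rw [← degree_exponents, hdeg], (hq w).1 hmq⟩
  · rintro ⟨w, hw, hlen, hcount⟩
    exact ⟨exponents w, (mem_support_toPoly_iff φ _).2 ⟨w, hw, rfl⟩, (hq w).2 hcount,
      by rw [degree_exponents, hlen]⟩

/-! ### Splitting variables -/

theorem prod_map_sum_eq_sum_sections {ι R : Type*} [Semiring R] (g : ι → R) (L : List (List ι)) :
    (L.map fun l => (l.map g).sum).prod = (L.sections.map fun α => (α.map g).prod).sum := by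
  induction L with
  | nil => simp only [List.map_nil, List.prod_nil, List.sections, List.map_cons, List.sum_singleton]
  | cons l L ih =>
    rw [List.map_cons, List.prod_cons, ih, ← List.sum_map_mul_left, List.sections,
      List.map_flatMap, List.flatMap_def, List.sum_flatten, List.map_map]
    simp only [Function.comp_def, List.map_map, List.map_cons, List.prod_cons,
      List.sum_map_mul_right]

/-- The words obtained from `w` by replacing each letter `i` by one of its copies `i * r + j`,
`j < r`. -/
def lifts (r : ℕ) (w : List ℕ) : List (List ℕ) :=
  (w.map fun i => (List.range r).map (i * r + ·)).sections

theorem mem_copies_iff {r i a : ℕ} :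
    a ∈ (List.range r).map (i * r + ·) ↔ 0 < r ∧ a / r = i := by
  simp only [List.mem_map, List.mem_range]
  constructor
  · rintro ⟨j, hj, rfl⟩
    have hr : 0 < r := by omega
    rw [mul_comm, Nat.mul_add_div hr, Nat.div_eq_of_lt hj, add_zero]
    exact ⟨hr, rfl⟩
  · rintro ⟨hr, rfl⟩
    exact ⟨a % r, Nat.mod_lt a hr, by rw [mul_comm]; exact Nat.div_add_mod a r⟩

theorem mem_lifts_iff {r : ℕ} {w α : List ℕ} :
    α ∈ lifts r w ↔ (∀ a ∈ α, 0 < r) ∧ α.map (· / r) = w := by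
  rw [lifts, List.mem_sections, List.forall₂_map_right_iff]
  simp only [mem_copies_iff]
  rw [List.forall₂_and_left, ← List.forall₂_eq_eq_eq, List.forall₂_map_left_iff]

theorem count_le_of_nodup {r : ℕ} {w α : List ℕ} (hα : α ∈ lifts r w) (hnd : α.Nodup) (i : ℕ) :
    w.count i ≤ r := by
  obtain ⟨hr, rfl⟩ := mem_lifts_iff.1 hα
  rw [List.count_eq_countP, List.countP_map, List.countP_eq_length_filter,
    ← List.toFinset_card_of_nodup (hnd.filter _)]
  have hsub : (α.filter ((· == i) ∘ (· / r))).toFinset ⊆ Finset.Ico (i * r) (i * r + r) := by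
    intro a ha
    simp only [List.mem_toFinset, List.mem_filter, Function.comp_apply, beq_iff_eq] at ha
    obtain ⟨hmem, rfl⟩ := ha
    exact Finset.mem_Ico.2 ⟨Nat.div_mul_le_self a r, Nat.lt_div_mul_add (hr a hmem)⟩
  exact (Finset.card_le_card hsub).trans (by rw [Nat.card_Ico, Nat.add_sub_cancel_left])

theorem exists_nodup_lift {r : ℕ} {w : List ℕ} (h : ∀ i, w.count i ≤ r) :
    ∃ α ∈ lifts r w, α.Nodup ∧ ∀ a ∈ α, a % r < w.count (a / r) := by
  induction w with
  | nil => exact ⟨[], mem_lifts_iff.2 ⟨by simp, rfl⟩, List.nodup_nil, by simp⟩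
  | cons i w ih =>
    have hle : ∀ i', w.count i' ≤ (i :: w).count i' := fun i' => List.count_le_count_cons
    obtain ⟨α, hα, hnd, hmod⟩ := ih fun i' => (hle i').trans (h i')
    have hi := h i
    rw [List.count_cons_self] at hi
    have hr : 0 < r := by omega
    have hdiv : (i * r + w.count i) / r = i := by
      rw [mul_comm, Nat.mul_add_div hr, Nat.div_eq_of_lt (by omega), add_zero]
    have hrem : (i * r + w.count i) % r = w.count i := by
      rw [mul_comm, Nat.mul_add_mod, Nat.mod_eq_of_lt (by omega)]
    refine ⟨(i * r + w.count i) :: α, mem_lifts_iff.2 ⟨fun _ _ => hr, ?_⟩,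
      List.nodup_cons.2 ⟨fun hmem => ?_, hnd⟩, List.forall_mem_cons.2 ⟨?_, fun a ha => ?_⟩⟩
    · rw [List.map_cons, hdiv, (mem_lifts_iff.1 hα).2]
    · have hlt := hmod _ hmem
      rw [hdiv, hrem] at hlt
      exact lt_irrefl _ hlt
    · rw [hdiv, hrem, List.count_cons_self]
      exact Nat.lt_succ_self _
    · exact (hmod a ha).trans_le (hle _)

theorem exists_nodup_mem_lifts_iff {r : ℕ} {w : List ℕ} :
    (∃ α ∈ lifts r w, α.Nodup) ↔ ∀ i, w.count i ≤ r := by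
  refine ⟨fun ⟨α, hα, hnd⟩ => count_le_of_nodup hα hnd, fun h => ?_⟩
  obtain ⟨α, hα, hnd, -⟩ := exists_nodup_lift h
  exact ⟨α, hα, hnd⟩

theorem forall_count_map_le_iff {ι κ : Type*} [DecidableEq ι] [DecidableEq κ] {f : ι → κ}
    (hf : Function.Injective f) {r : ℕ} {w : List ι} :
    (∀ j, (w.map f).count j ≤ r) ↔ ∀ i, w.count i ≤ r := by
  refine ⟨fun h i => List.count_map_of_injective w f hf i ▸ h (f i), fun h j => ?_⟩
  by_cases hj : j ∈ w.map f
  · obtain ⟨i, -, rfl⟩ := List.mem_map.1 hj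
    rw [List.count_map_of_injective w f hf]
    exact h i
  · rw [List.count_eq_zero_of_not_mem hj]
    exact Nat.zero_le r

/-! ### The algebra of states -/

/-- The number of basis states: two masks of `k` bits and a sign, which is stored in the state
because the program computes with natural numbers. -/
def dim (k : ℕ) : ℕ := 2 ^ k * 2 ^ k * 2

/-- The first mask of a state. -/
def maskS (k X : ℕ) : ℕ := X / 2 / 2 ^ k

/-- The second mask of a state. -/
def maskT (k X : ℕ) : ℕ := X / 2 % 2 ^ k

/-- Bit `s` can be added to the first and bit `t` to the second mask of the state `X`. -/
abbrev IsFree (k X s t : ℕ) : Prop := IsClear (maskS k X) s ∧ IsClear (maskT k X) t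

/-- The state reached from `X` by adding bit `s` to the first and bit `t` to the second mask. -/
def target (k X s t : ℕ) : ℕ :=
  ((maskS k X + 2 ^ s) * 2 ^ k + (maskT k X + 2 ^ t)) * 2 +
    (popCount (maskS k X / 2 ^ s) + popCount (maskT k X / 2 ^ t) + X % 2) % 2

theorem dim_pos (k : ℕ) : 0 < dim k := by
  rw [dim]
  positivity

theorem maskT_lt (k X : ℕ) : maskT k X < 2 ^ k := Nat.mod_lt _ (by positivity)

theorem maskS_lt {k X : ℕ} (h : X < dim k) : maskS k X < 2 ^ k := by
  rw [maskS, Nat.div_div_eq_div_mul]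
  refine Nat.div_lt_of_lt_mul ?_
  rw [dim] at h
  linarith

theorem target_div_two (k X s t : ℕ) :
    target k X s t / 2 = 2 ^ k * (maskS k X + 2 ^ s) + (maskT k X + 2 ^ t) := by
  rw [target, mul_comm (2 ^ k)]
  omega

theorem target_mod_two (k X s t : ℕ) : target k X s t % 2 =
    (popCount (maskS k X / 2 ^ s) + popCount (maskT k X / 2 ^ t) + X % 2) % 2 := by
  rw [target]
  omega

section Target

variable {k X s t : ℕ}

theorem maskS_target (h : IsFree k X s t) (ht : t < k) :
    maskS k (target k X s t) = maskS k X + 2 ^ s := by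
  rw [maskS, target_div_two, Nat.mul_add_div (by positivity),
    Nat.div_eq_of_lt (add_two_pow_lt h.2 ht (maskT_lt k X)), add_zero]

theorem maskT_target (h : IsFree k X s t) (ht : t < k) :
    maskT k (target k X s t) = maskT k X + 2 ^ t := by
  rw [maskT, target_div_two, Nat.mul_add_mod,
    Nat.mod_eq_of_lt (add_two_pow_lt h.2 ht (maskT_lt k X))]

theorem target_lt (hX : X < dim k) (h : IsFree k X s t) (hs : s < k) (ht : t < k) :
    target k X s t < dim k := by
  have hT := add_two_pow_lt h.2 ht (maskT_lt k X)
  have hS := add_two_pow_lt h.1 hs (maskS_lt hX)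
  have hmul : (maskS k X + 2 ^ s + 1) * 2 ^ k ≤ 2 ^ k * 2 ^ k := Nat.mul_le_mul_right _ hS
  rw [add_mul, one_mul] at hmul
  rw [target, dim]
  omega

end Target

/-- Multiplication by the copy `a`, on functions of states. -/
def copyOp (k a : ℕ) : AddMonoid.End (ℕ → ℕ) where
  toFun f Z := ∑ X ∈ Finset.range (dim k), ∑ s ∈ Finset.range k, ∑ t ∈ Finset.range k,
    if IsFree k X s t ∧ target k X s t = Z then 2 ^ (a * (s + t)) * f X else 0
  map_zero' := by
    funext Z
    simp only [Pi.zero_apply, mul_zero, ite_self, Finset.sum_const_zero]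
  map_add' f g := by
    funext Z
    simp only [Pi.add_apply, ← Finset.sum_add_distrib, mul_add, ite_add_ite, add_zero]

theorem copyOp_apply (k a : ℕ) (f : ℕ → ℕ) (Z : ℕ) : copyOp k a f Z =
    ∑ X ∈ Finset.range (dim k), ∑ s ∈ Finset.range k, ∑ t ∈ Finset.range k,
      if IsFree k X s t ∧ target k X s t = Z then 2 ^ (a * (s + t)) * f X else 0 := rfl

/-- Multiplication by the variable `i`, the sum of its `r` copies. -/
def leafOp (k r i : ℕ) : AddMonoid.End (ℕ → ℕ) := ∑ j ∈ Finset.range r, copyOp k (i * r + j)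

/-- The pairing of functions of states with the functional `ψ`. -/
def pairing (k : ℕ) (ψ : ℕ → ℤ) : (ℕ → ℕ) →+ ℤ where
  toFun f := ∑ X ∈ Finset.range (dim k), f X * ψ X
  map_zero' := by simp only [Pi.zero_apply, Nat.cast_zero, zero_mul, Finset.sum_const_zero]
  map_add' f g := by
    simp only [Pi.add_apply, Nat.cast_add, add_mul, Finset.sum_add_distrib]

theorem pairing_apply (k : ℕ) (ψ : ℕ → ℤ) (f : ℕ → ℕ) :
    pairing k ψ f = ∑ X ∈ Finset.range (dim k), f X * ψ X := rfl

/-- The functional `A ⊗ B` on states, with the sign of the state taken into account. -/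
def signedTensor (k : ℕ) (A B : ℕ → ℤ) (X : ℕ) : ℤ :=
  (-1) ^ (X % 2) * (A (maskS k X) * B (maskT k X))

theorem signedTensor_vandermondeCreation (k a : ℕ) (A B : ℕ → ℤ) (X : ℕ) :
    signedTensor k (vandermondeCreation k a A) (vandermondeCreation k a B) X =
      ∑ s ∈ Finset.range k, ∑ t ∈ Finset.range k, if IsFree k X s t then
        2 ^ (a * (s + t)) * signedTensor k A B (target k X s t) else 0 := by
  rw [signedTensor, vandermondeCreation_apply, vandermondeCreation_apply, Finset.sum_mul_sum,
    Finset.mul_sum]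
  refine Finset.sum_congr rfl fun s _ => ?_
  rw [Finset.mul_sum]
  refine Finset.sum_congr rfl fun t ht => ?_
  rw [ite_zero_mul_ite_zero]
  split_ifs with h
  · have htk := Finset.mem_range.1 ht
    rw [signedTensor, maskS_target h htk, maskT_target h htk, target_mod_two]
    simp only [← neg_one_pow_eq_pow_mod_two, pow_add]
    ring
  · rw [mul_zero]

theorem pairing_copyOp_signedTensor (k a : ℕ) (A B : ℕ → ℤ) (f : ℕ → ℕ) :
    pairing k (signedTensor k A B) (copyOp k a f) =
      pairing k (signedTensor k (vandermondeCreation k a A) (vandermondeCreation k a B)) f := by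
  simp only [pairing_apply, copyOp_apply, Nat.cast_sum, Finset.sum_mul,
    signedTensor_vandermondeCreation, Finset.mul_sum]
  rw [Finset.sum_comm]
  refine Finset.sum_congr rfl fun X hX => ?_
  rw [Finset.sum_comm]
  refine Finset.sum_congr rfl fun s hs => ?_
  rw [Finset.sum_comm]
  refine Finset.sum_congr rfl fun t ht => ?_
  rw [Finset.mem_range] at hX hs ht
  by_cases h : IsFree k X s t
  · rw [Finset.sum_eq_single_of_mem (target k X s t)
      (Finset.mem_range.2 (target_lt hX h hs ht)) fun Z _ hZ => by
        rw [if_neg fun h' => hZ h'.2.symm, Nat.cast_zero, zero_mul], if_pos ⟨h, rfl⟩, if_pos h]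
    push_cast
    ring
  · rw [if_neg h, mul_zero]
    exact Finset.sum_eq_zero fun Z _ => by rw [if_neg fun h' => h h'.1, Nat.cast_zero, zero_mul]

theorem pairing_prod_copyOp (k : ℕ) (α : List ℕ) (A B : ℕ → ℤ) (f : ℕ → ℕ) :
    pairing k (signedTensor k A B) ((α.map (copyOp k)).prod f) =
      pairing k (signedTensor k ((α.reverse.map (vandermondeCreation k)).prod A)
        ((α.reverse.map (vandermondeCreation k)).prod B)) f := by
  induction α generalizing A B with
  | nil => rfl
  | cons a α ih =>
    rw [List.reverse_cons, List.map_append, List.prod_append, List.map_singleton,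
      List.prod_singleton]
    exact (pairing_copyOp_signedTensor k a A B _).trans (ih _ _)

theorem pairing_single (k : ℕ) (ψ : ℕ → ℤ) : pairing k ψ (Pi.single 0 1) = ψ 0 := by
  rw [pairing_apply, Finset.sum_eq_single_of_mem 0 (Finset.mem_range.2 (dim_pos k))
    fun X _ hX => by rw [Pi.single_eq_of_ne hX, Nat.cast_zero, zero_mul], Pi.single_eq_same,
    Nat.cast_one, one_mul]

/-- The top coefficient of the value `T 1`, where `T` is an operator on states. -/
def topCoeff (k : ℕ) : AddMonoid.End (ℕ → ℕ) →+ ℤ :=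
  (pairing k (signedTensor k (fullMask ℤ k) (fullMask ℤ k))).comp
    (AddMonoidHom.eval (Pi.single 0 1))

theorem topCoeff_prod_copyOp (k : ℕ) (α : List ℕ) :
    topCoeff k (α.map (copyOp k)).prod = extProd k α.reverse 0 ^ 2 := by
  refine (pairing_prod_copyOp k α _ _ _).trans ?_
  rw [pairing_single, signedTensor, Nat.zero_mod, pow_zero, one_mul, sq, maskS, maskT, extProd,
    Nat.zero_div, Nat.zero_div, Nat.zero_mod]

theorem topCoeff_prod_copyOp_pos_iff (k : ℕ) (α : List ℕ) :
    0 < topCoeff k (α.map (copyOp k)).prod ↔ α.length = k ∧ α.Nodup := by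
  rw [topCoeff_prod_copyOp, sq_pos_iff, extProd_apply_zero_ne_zero_iff, List.length_reverse,
    List.nodup_reverse]

theorem signedTensor_fullMask (k X : ℕ) : signedTensor k (fullMask ℤ k) (fullMask ℤ k) X =
    (if X = dim k - 2 then 1 else 0) - if X = dim k - 1 then 1 else 0 := by
  have hpos : 0 < 2 ^ k := by positivity
  have hle : 2 ^ k ≤ 2 ^ k * 2 ^ k := Nat.le_mul_of_pos_left _ hpos
  have hdecomp : 2 ^ k - 1 + 2 ^ k * (2 ^ k - 1) = 2 ^ k * 2 ^ k - 1 := by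
    rw [Nat.mul_sub, mul_one]
    omega
  have hfull : maskS k X = 2 ^ k - 1 ∧ maskT k X = 2 ^ k - 1 ↔ X / 2 = 2 ^ k * 2 ^ k - 1 := by
    rw [maskS, maskT, Nat.div_mod_unique hpos, hdecomp]
    omega
  rw [signedTensor, fullMask, fullMask, ite_zero_mul_ite_zero, if_congr hfull rfl rfl, mul_one, dim]
  rcases Nat.mod_two_eq_zero_or_one X with hX | hX
  · rw [hX, pow_zero, one_mul, if_neg (show X ≠ 2 ^ k * 2 ^ k * 2 - 1 by omega), sub_zero]
    exact if_congr (by omega) rfl rfl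
  · rw [hX, pow_one, if_neg (show X ≠ 2 ^ k * 2 ^ k * 2 - 2 by omega), zero_sub, neg_one_mul]
    exact congrArg _ (if_congr (by omega) rfl rfl)

theorem topCoeff_apply (k : ℕ) (T : AddMonoid.End (ℕ → ℕ)) :
    topCoeff k T = T (Pi.single 0 1) (dim k - 2) - T (Pi.single 0 1) (dim k - 1) := by
  have hdim : 2 ≤ dim k := by
    rw [dim]
    exact Nat.le_mul_of_pos_left 2 (by positivity)
  refine (pairing_apply k _ (T (Pi.single 0 1))).trans ?_
  simp only [signedTensor_fullMask, mul_sub, mul_ite, mul_one, mul_zero, Finset.sum_sub_distrib,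
    Finset.sum_ite_eq', Finset.mem_range]
  rw [if_pos (by omega), if_pos (by omega)]

theorem evalIn_leafOp_eq_sum {n : ℕ} (k r : ℕ) (φ : Formula n) :
    φ.evalIn (fun i => leafOp k r i) =
      ((φ.words.flatMap fun w => lifts r (w.map Fin.val)).map fun α =>
        (α.map (copyOp k)).prod).sum := by
  have hleaf : ∀ i, leafOp k r i = (((List.range r).map (i * r + ·)).map (copyOp k)).sum :=
    fun i => by rw [List.map_map]; rfl
  rw [φ.evalIn_eq_sum_words, List.map_flatMap, List.flatMap_def, List.sum_flatten, List.map_map]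
  refine congrArg List.sum (List.map_congr_left fun w _ => ?_)
  rw [Function.comp_apply, lifts, ← prod_map_sum_eq_sum_sections, List.map_map, List.map_map]
  simp only [hleaf, Function.comp_def]

theorem hasQMonomial_iff_states {n : ℕ} (r k : ℕ) (φ : Formula n) :
    HasQMonomial (r + 1) k φ.toPoly ↔
      φ.evalIn (fun i => leafOp k r i) (Pi.single 0 1) (dim k - 1) <
        φ.evalIn (fun i => leafOp k r i) (Pi.single 0 1) (dim k - 2) := by
  have hlift : ∀ w : List (Fin n), (w.length = k ∧ ∀ i, w.count i ≤ r) ↔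
      ∃ α ∈ lifts r (w.map Fin.val), α.length = k ∧ α.Nodup := by
    intro w
    have hlength : ∀ α ∈ lifts r (w.map Fin.val), α.length = w.length := fun α hα => by
      rw [← List.length_map (f := (· / r)), (mem_lifts_iff.1 hα).2, List.length_map]
    rw [← forall_count_map_le_iff Fin.val_injective, ← exists_nodup_mem_lifts_iff]
    constructor
    · rintro ⟨rfl, α, hα, hnd⟩
      exact ⟨α, hα, hlength α hα, hnd⟩
    · rintro ⟨α, hα, rfl, hnd⟩
      exact ⟨(hlength α hα).symm, α, hα, hnd⟩
  rw [← Nat.cast_lt (α := ℤ), ← sub_pos, ← topCoeff_apply, evalIn_leafOp_eq_sum, map_list_sum,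
    List.map_map, sum_map_pos_iff fun α => by
      rw [Function.comp_apply, topCoeff_prod_copyOp]; exact sq_nonneg _,
    hasQMonomial_iff_words]
  simp only [Function.comp_apply, topCoeff_prod_copyOp_pos_iff, List.mem_flatMap, hlift]
  exact ⟨fun ⟨w, hw, α, hα, h⟩ => ⟨α, ⟨w, hw, hα⟩, h⟩, fun ⟨α, ⟨w, hw, hα⟩, h⟩ => ⟨w, hw, α, hα, h⟩⟩

/-! ### Cost of programs on bounded memory -/

/-- All numbers in the memory have at most `L` bits, where `L` is positive: the invariant under
which the logarithmic cost of every single step is controlled. -/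
structure Bounded (L : ℕ) (σ : Memory) : Prop where
  one_le : 1 ≤ L
  reg_lt : ∀ x, σ.reg x < 2 ^ L
  arr_lt : ∀ a i, σ.arr a i < 2 ^ L

theorem Bounded.setReg {L : ℕ} {σ : Memory} (h : Bounded L σ) (x : ℕ) {v : ℕ} (hv : v < 2 ^ L) :
    Bounded L (σ.setReg x v) where
  one_le := h.one_le
  reg_lt y := by
    simp only [Memory.setReg, Function.update_apply]
    split_ifs
    exacts [hv, h.reg_lt y]
  arr_lt := h.arr_lt

theorem Bounded.setArr {L : ℕ} {σ : Memory} (h : Bounded L σ) (a i : ℕ) {v : ℕ}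
    (hv : v < 2 ^ L) : Bounded L (σ.setArr a i v) where
  one_le := h.one_le
  reg_lt := h.reg_lt
  arr_lt b j := by
    simp only [Memory.setArr, Function.update_apply]
    split_ifs with hb
    · rw [Function.update_apply]
      split_ifs
      exacts [hv, h.arr_lt a j]
    · exact h.arr_lt b j

/-- The weight of an expression: on memory of bit length `L`, the value of `e` has at most
`e.weight * L` bits and `e` is evaluated in time quadratic in that number. -/
def Expr.weight : Expr → ℕ
  | const c => c + 1
  | reg _ => 1
  | load _ i => i.weight + 1
  | add e f => e.weight + f.weight
  | sub e f => e.weight + f.weight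
  | mul e f => e.weight + f.weight
  | div e f => e.weight + f.weight

theorem Expr.one_le_weight (e : Expr) : 1 ≤ e.weight := by
  induction e <;> simp only [Expr.weight] <;> omega

theorem Expr.one_le_weight_mul {L : ℕ} (hL : 1 ≤ L) (e : Expr) : 1 ≤ e.weight * L :=
  Nat.mul_pos e.one_le_weight hL

theorem Expr.eval_lt {L : ℕ} {σ : Memory} (h : Bounded L σ) (e : Expr) :
    e.eval σ < 2 ^ (e.weight * L) := by
  have hmono {a b : ℕ} (hab : a ≤ b) : 2 ^ (a * L) ≤ 2 ^ (b * L) :=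
    Nat.pow_le_pow_right two_pos (Nat.mul_le_mul_right L hab)
  have two_le (e : Expr) : 2 ≤ 2 ^ (e.weight * L) :=
    le_self_pow one_le_two (Nat.one_le_iff_ne_zero.1 (e.one_le_weight_mul h.one_le))
  induction e with
  | const c =>
    calc c < 2 ^ (c + 1) := (Nat.lt_succ_self c).trans Nat.lt_two_pow_self
      _ ≤ 2 ^ ((c + 1) * L) := Nat.pow_le_pow_right two_pos (Nat.le_mul_of_pos_right _ h.one_le)
  | reg x => simpa only [Expr.eval, Expr.weight, one_mul] using h.reg_lt x
  | load a i _ =>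
    calc σ.arr a (i.eval σ) < 2 ^ (1 * L) := by simpa only [one_mul] using h.arr_lt a _
      _ ≤ 2 ^ ((i.weight + 1) * L) := hmono (by omega)
  | add e f he hf =>
    simp only [Expr.eval, Expr.weight, add_mul, pow_add]
    exact (add_lt_add he hf).trans_le (Nat.add_le_mul (two_le e) (two_le f))
  | sub e f he _ => exact ((Nat.sub_le _ _).trans_lt he).trans_le (hmono (Nat.le_add_right _ _))
  | mul e f he hf =>
    simp only [Expr.eval, Expr.weight, add_mul, pow_add]
    exact Nat.mul_lt_mul'' he hf
  | div e f he _ =>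
    exact ((Nat.div_le_self _ _).trans_lt he).trans_le (hmono (Nat.le_add_right _ _))

theorem Expr.bits_eval_le {L : ℕ} {σ : Memory} (h : Bounded L σ) (e : Expr) :
    bits (e.eval σ) ≤ 2 * (e.weight * L) := by
  have hsize : Nat.size (e.eval σ) ≤ e.weight * L := Nat.size_le.2 (e.eval_lt h)
  have hpos := e.one_le_weight_mul h.one_le
  rw [bits]
  omega

theorem Expr.cost_le {L : ℕ} {σ : Memory} (h : Bounded L σ) (e : Expr) :
    e.cost σ ≤ 4 * (e.weight * L) ^ 2 := by
  have hpos (e : Expr) := e.one_le_weight_mul h.one_le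
  have atom (e : Expr) (he : e.cost σ = bits (e.eval σ)) : e.cost σ ≤ 4 * (e.weight * L) ^ 2 := by
    rw [he]
    nlinarith [e.bits_eval_le h, hpos e]
  have sum (e f : Expr) : bits (e.eval σ) + bits (f.eval σ) ≤
      8 * (e.weight * L * (f.weight * L)) := by
    nlinarith [e.bits_eval_le h, f.bits_eval_le h, hpos e, hpos f]
  have prod (e f : Expr) : bits (e.eval σ) * bits (f.eval σ) ≤
      8 * (e.weight * L * (f.weight * L)) := by
    nlinarith [Nat.mul_le_mul (e.bits_eval_le h) (f.bits_eval_le h)]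
  have square (a b : ℕ) : 4 * ((a + b) * L) ^ 2 =
      4 * (a * L) ^ 2 + 4 * (b * L) ^ 2 + 8 * (a * L * (b * L)) := by ring
  induction e with
  | const c => exact atom (.const c) rfl
  | reg x => exact atom (.reg x) rfl
  | load a i hi =>
    have hload := (Expr.load a i).bits_eval_le h
    have hindex := i.bits_eval_le h
    simp only [Expr.eval, Expr.weight] at hload
    simp only [Expr.cost, Expr.weight]
    nlinarith [hpos i, h.one_le]
  | add e f he hf | sub e f he hf =>
    simp only [Expr.cost, Expr.weight, square]
    linarith [sum e f]
  | mul e f he hf | div e f he hf =>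
    simp only [Expr.cost, Expr.weight, square]
    linarith [prod e f]

theorem Expr.cost_add_bits_le {L : ℕ} {σ : Memory} (h : Bounded L σ) (e : Expr) :
    e.cost σ + bits (e.eval σ) + 1 ≤ 7 * (e.weight * L) ^ 2 := by
  nlinarith [e.cost_le h, e.bits_eval_le h, e.one_le_weight_mul h.one_le]

/-- The weight of a program; it bounds the cost of a single step, up to the bit lengths. -/
def Program.weight : Program → ℕ
  | skip => 1
  | assign _ e => 7 * e.weight ^ 2
  | store _ i e => 7 * (i.weight + e.weight) ^ 2
  | seq P Q => P.weight + Q.weight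
  | cond e P Q => 7 * e.weight ^ 2 + (P.weight + Q.weight)
  | loop e P => 7 * e.weight ^ 2 + P.weight

/-- Started in `σ`, the program halts after at most `N` steps on numbers of at most `L` bits, in a
memory that satisfies `Q`. Time is recorded relative to the weight of the program, so that the step
counts of subprograms simply add up. -/
def Runs (L : ℕ) (P : Program) (σ : Memory) (N : ℕ) (Q : Memory → Prop) : Prop :=
  ∃ τ t, Exec P σ τ t ∧ t ≤ P.weight * L ^ 2 * N ∧ Q τ

namespace Runs

variable {L N N' : ℕ} {P P' : Program} {σ : Memory} {Q Q' : Memory → Prop} {e : Expr}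

theorem mono (h : Runs L P σ N Q) (hN : N ≤ N') (hQ : ∀ τ, Q τ → Q' τ) : Runs L P σ N' Q' := by
  obtain ⟨τ, t, hexec, ht, hτ⟩ := h
  exact ⟨τ, t, hexec, ht.trans (Nat.mul_le_mul_left _ hN), hQ τ hτ⟩

theorem skip (hL : 1 ≤ L) (h : Q σ) : Runs L .skip σ 1 Q :=
  ⟨σ, 1, Exec.skip σ, by rw [Program.weight, one_mul, mul_one]; exact Nat.pow_pos hL, h⟩

theorem test_cost_le (hB : Bounded L σ) (e : Expr) : e.cost σ + 1 ≤ 7 * e.weight ^ 2 * L ^ 2 := by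
  have := e.cost_add_bits_le hB
  rw [mul_assoc, ← mul_pow]
  omega

theorem assign {x v : ℕ} (hB : Bounded L σ) (hv : e.eval σ = v) (h : Q (σ.setReg x v)) :
    Runs L (.assign x e) σ 1 Q := by
  refine ⟨_, _, Exec.assign x e σ, ?_, hv ▸ h⟩
  rw [Program.weight, mul_one, mul_assoc, ← mul_pow]
  exact e.cost_add_bits_le hB

theorem store {a j v : ℕ} {i : Expr} (hB : Bounded L σ) (hi : i.eval σ = j) (hv : e.eval σ = v)
    (h : Q (σ.setArr a j v)) : Runs L (.store a i e) σ 1 Q := by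
  refine ⟨_, _, Exec.store a i e σ, ?_, hi ▸ hv ▸ h⟩
  have hindex := i.cost_add_bits_le hB
  have hvalue := e.cost_add_bits_le hB
  rw [Program.weight, mul_one, mul_assoc, ← mul_pow, add_mul]
  linarith [Nat.zero_le (i.weight * L * (e.weight * L)),
    add_sq (i.weight * L) (e.weight * L)]

theorem seq (h : Runs L P σ N fun τ => Runs L P' τ N' Q) : Runs L (.seq P P') σ (N + N') Q := by
  obtain ⟨τ, t, hP, ht, ρ, u, hP', hu, hρ⟩ := h
  refine ⟨ρ, t + u, Exec.seq hP hP', (add_le_add ht hu).trans ?_, hρ⟩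
  rw [Program.weight, add_mul, add_mul]
  gcongr <;> omega

theorem cond (hB : Bounded L σ) (h1 : e.eval σ ≠ 0 → Runs L P σ N Q)
    (h2 : e.eval σ = 0 → Runs L P' σ N Q) : Runs L (.cond e P P') σ (N + 1) Q := by
  have htest := test_cost_le hB e
  have hweight : (Program.cond e P P').weight * L ^ 2 * (N + 1) =
      7 * e.weight ^ 2 * L ^ 2 + P.weight * L ^ 2 * N + P'.weight * L ^ 2 * N +
      (7 * e.weight ^ 2 * L ^ 2 * N + (P.weight + P'.weight) * L ^ 2) := by
    rw [Program.weight]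
    ring
  by_cases h : e.eval σ = 0
  · obtain ⟨τ, t, hexec, ht, hτ⟩ := h2 h
    exact ⟨τ, _, Exec.cond_false h hexec, by omega, hτ⟩
  · obtain ⟨τ, t, hexec, ht, hτ⟩ := h1 h
    exact ⟨τ, _, Exec.cond_true h hexec, by omega, hτ⟩

theorem loop {m : ℕ} (I : ℕ → Memory → Prop)
    (hbody : ∀ i < m, ∀ τ, I i τ → Bounded L τ ∧ e.eval τ ≠ 0 ∧ Runs L P τ N (I (i + 1)))
    (hend : ∀ τ, I m τ → Bounded L τ ∧ e.eval τ = 0) (h0 : I 0 σ) :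
    Runs L (.loop e P) σ (m * (N + 1) + 1) (I m) := by
  suffices ∀ d i, i + d = m → ∀ τ, I i τ → Runs L (.loop e P) τ (d * (N + 1) + 1) (I m) from
    this m 0 (Nat.zero_add m) σ h0
  intro d
  induction d with
  | zero =>
    rintro i rfl τ hτ
    obtain ⟨hB, he⟩ := hend τ hτ
    refine ⟨τ, _, Exec.loop_stop he, (test_cost_le hB e).trans ?_, hτ⟩
    rw [Program.weight, zero_mul, zero_add, mul_one]
    gcongr
    exact Nat.le_add_right _ _
  | succ d ih =>
    intro i hi τ hτ
    obtain ⟨hB, he, ρ, t, hexec, ht, hρ⟩ := hbody i (by omega) τ hτ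
    obtain ⟨ρ', u, hexec', hu, hρ'⟩ := ih (i + 1) (by omega) ρ hρ
    have htest := test_cost_le hB e
    refine ⟨ρ', _, Exec.loop_step he hexec hexec', ?_, hρ'⟩
    rw [Program.weight] at hu ⊢
    have : (7 * e.weight ^ 2 + P.weight) * L ^ 2 * ((d + 1) * (N + 1) + 1) =
      (7 * e.weight ^ 2 + P.weight) * L ^ 2 * (d * (N + 1) + 1) + 7 * e.weight ^ 2 * L ^ 2 +
      P.weight * L ^ 2 * N + (7 * e.weight ^ 2 * L ^ 2 * N + P.weight * L ^ 2) := by ring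
    omega

theorem assign_seq {x v : ℕ} (hB : Bounded L σ) (hv : e.eval σ = v) (hlt : v < 2 ^ L)
    (h : Bounded L (σ.setReg x v) → Runs L P (σ.setReg x v) N Q) :
    Runs L (.seq (.assign x e) P) σ (1 + N) Q :=
  (assign hB hv (h (hB.setReg x hlt))).seq

theorem store_seq {a j v : ℕ} {i : Expr} (hB : Bounded L σ) (hi : i.eval σ = j)
    (hv : e.eval σ = v) (hlt : v < 2 ^ L)
    (h : Bounded L (σ.setArr a j v) → Runs L P (σ.setArr a j v) N Q) :
    Runs L (.seq (.store a i e) P) σ (1 + N) Q :=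
  (store hB hi hv (h (hB.setArr a j hlt))).seq

end Runs

/-! ### The transitions of a leaf -/

/-- The number of quadruples `(X, s, t, j)` of a state, two bits and a copy of a variable. A leaf of
the formula runs through them in a single loop, whose counter is `((X * k + s) * k + t) * r + j`. -/
def transitions (k r : ℕ) : ℕ := dim k * k * k * r

/-- The state `X` of the transition with number `c`. -/
def stateAt (k r c : ℕ) : ℕ := c / r / k / k

/-- The bit `s` of the transition with number `c`. -/
def bitSAt (k r c : ℕ) : ℕ := c / r / k % k

/-- The bit `t` of the transition with number `c`. -/
def bitTAt (k r c : ℕ) : ℕ := c / r % k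

/-- The contribution of the transition with number `c` to `leafOp k r i f`. -/
def leafTerm (k r i : ℕ) (f : ℕ → ℕ) (c : ℕ) : ℕ → ℕ :=
  if IsFree k (stateAt k r c) (bitSAt k r c) (bitTAt k r c) then
    Pi.single (target k (stateAt k r c) (bitSAt k r c) (bitTAt k r c))
      (2 ^ ((i * r + c % r) * (bitSAt k r c + bitTAt k r c)) * f (stateAt k r c))
  else 0

theorem sum_range_mul_eq {M : Type*} [AddCommMonoid M] (a b : ℕ) (g : ℕ → ℕ → M) :
    ∑ c ∈ Finset.range (a * b), g (c / b) (c % b) =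
      ∑ x ∈ Finset.range a, ∑ y ∈ Finset.range b, g x y := by
  induction a with
  | zero => simp only [zero_mul, Finset.range_zero, Finset.sum_empty]
  | succ a ih =>
    rw [add_mul, one_mul, Finset.sum_range_add, ih, Finset.sum_range_succ]
    congr 1
    refine Finset.sum_congr rfl fun y hy => ?_
    have hy := Finset.mem_range.1 hy
    rw [mul_comm a b, Nat.mul_add_div (by omega), Nat.div_eq_of_lt hy, add_zero, Nat.mul_add_mod,
      Nat.mod_eq_of_lt hy]

theorem leafOp_eq_sum_leafTerm (k r i : ℕ) (f : ℕ → ℕ) :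
    leafOp k r i f = ∑ c ∈ Finset.range (transitions k r), leafTerm k r i f c := by
  let G (X s t j : ℕ) : ℕ → ℕ :=
    if IsFree k X s t then Pi.single (target k X s t) (2 ^ ((i * r + j) * (s + t)) * f X) else 0
  have hcopy (j : ℕ) : copyOp k (i * r + j) f = ∑ X ∈ Finset.range (dim k),
      ∑ s ∈ Finset.range k, ∑ t ∈ Finset.range k, G X s t j := by
    funext Z
    simp only [copyOp_apply, Finset.sum_apply, G, ite_apply, Pi.single_apply, Pi.zero_apply,
      ite_and, eq_comm]
  calc leafOp k r i f
      = ∑ X ∈ Finset.range (dim k), ∑ s ∈ Finset.range k, ∑ t ∈ Finset.range k,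
          ∑ j ∈ Finset.range r, G X s t j := by
        rw [show leafOp k r i f = ∑ j ∈ Finset.range r, copyOp k (i * r + j) f from
          AddMonoidHom.finsetSum_apply _ _ _, Finset.sum_congr rfl fun j _ => hcopy j,
          Finset.sum_comm]
        refine Finset.sum_congr rfl fun X _ => ?_
        rw [Finset.sum_comm]
        exact Finset.sum_congr rfl fun s _ => Finset.sum_comm
    _ = ∑ c ∈ Finset.range (transitions k r), leafTerm k r i f c := by
        rw [transitions, ← sum_range_mul_eq (dim k), ← sum_range_mul_eq (dim k * k),
          ← sum_range_mul_eq (dim k * k * k)]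
        rfl

section Transition

variable {k r c : ℕ}

theorem stateAt_lt (hc : c < transitions k r) : stateAt k r c < dim k :=
  Nat.div_lt_of_lt_mul (Nat.div_lt_of_lt_mul (Nat.div_lt_of_lt_mul (by
    rw [transitions] at hc
    linarith)))

theorem bitSAt_lt (hc : c < transitions k r) : bitSAt k r c < k :=
  Nat.mod_lt _ (Nat.pos_of_ne_zero fun hk => by simp [transitions, hk] at hc)

theorem bitTAt_lt (hc : c < transitions k r) : bitTAt k r c < k :=
  Nat.mod_lt _ (Nat.pos_of_ne_zero fun hk => by simp [transitions, hk] at hc)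

theorem exponent_le {n i : ℕ} (hi : i < n) (hc : c < transitions k r) :
    (i * r + c % r) * (bitSAt k r c + bitTAt k r c) ≤ 2 * n * r * k := by
  have hr : c % r < r := Nat.mod_lt _ (Nat.pos_of_ne_zero fun hr => by simp [transitions, hr] at hc)
  have hs := bitSAt_lt hc
  have ht := bitTAt_lt hc
  calc (i * r + c % r) * (bitSAt k r c + bitTAt k r c) ≤ ((i + 1) * r) * (k + k) :=
        Nat.mul_le_mul (by rw [add_mul]; omega) (by omega)
    _ ≤ (n * r) * (k + k) := Nat.mul_le_mul_right _ (Nat.mul_le_mul_right _ hi)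
    _ = 2 * n * r * k := by ring

theorem leafTerm_le {n i B : ℕ} {f : ℕ → ℕ} (hi : i < n) (hc : c < transitions k r)
    (hf : ∀ X, f X ≤ B) (Z : ℕ) : leafTerm k r i f c Z ≤ 2 ^ (2 * n * r * k) * B := by
  rw [leafTerm]
  split_ifs
  · rw [Pi.single_apply]
    split_ifs
    · exact Nat.mul_le_mul (Nat.pow_le_pow_right two_pos (exponent_le hi hc)) (hf _)
    · exact Nat.zero_le _
  · exact Nat.zero_le _

theorem sum_leafTerm_le {n i B : ℕ} {f : ℕ → ℕ} (hi : i < n) (hc : c ≤ transitions k r)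
    (hf : ∀ X, f X ≤ B) (Z : ℕ) : (∑ d ∈ Finset.range c, leafTerm k r i f d) Z ≤
      transitions k r * (2 ^ (2 * n * r * k) * B) := by
  rw [Finset.sum_apply]
  calc ∑ d ∈ Finset.range c, leafTerm k r i f d Z
      ≤ ∑ _d ∈ Finset.range c, 2 ^ (2 * n * r * k) * B :=
        Finset.sum_le_sum fun d hd => leafTerm_le hi ((Finset.mem_range.1 hd).trans_le hc) hf Z
    _ = c * (2 ^ (2 * n * r * k) * B) := by rw [Finset.sum_const, Finset.card_range, smul_eq_mul]
    _ ≤ _ := Nat.mul_le_mul_right _ hc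

end Transition

/-! ### Registers and memory -/

-- Register `0` holds the number of variables on input and the answer on output; it needs no name.
local notation "rDeg" => 1
local notation "rPos" => 2
local notation "rMasks" => 3
local notation "rCtr" => 4
local notation "rTop" => 5
local notation "rFresh" => 6
local notation "rSrc" => 7
local notation "rSink" => 8
local notation "rArg" => 9
local notation "aCode" => 0
local notation "aVal" => 1
local notation "aPow" => 2
local notation "aCount" => 3
local notation "aSrc" => 4
local notation "aSink" => 5

namespace Memory

variable (σ : Memory)

@[simp]
theorem setReg_reg (x v y : ℕ) : (σ.setReg x v).reg y = if y = x then v else σ.reg y :=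
  Function.update_apply ..

@[simp]
theorem setReg_arr (x v : ℕ) : (σ.setReg x v).arr = σ.arr := rfl

@[simp]
theorem setArr_reg (a i v : ℕ) : (σ.setArr a i v).reg = σ.reg := rfl

@[simp]
theorem setArr_arr (a i v b j : ℕ) :
    (σ.setArr a i v).arr b j = if b = a ∧ j = i then v else σ.arr b j := by
  simp only [Memory.setArr, Function.update_apply, ite_apply, ite_and]
  split_ifs with h
  exacts [rfl, by rw [h], rfl]

theorem setArr_arr_of_ne {a b : ℕ} (i v : ℕ) (h : b ≠ a) : (σ.setArr a i v).arr b = σ.arr b :=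
  Function.update_of_ne h ..

end Memory

/-- Agreement of two memories outside of the registers in `R` and the arrays in `A`: the frame
condition of a program that writes only to these. -/
structure SameExcept (R A : List ℕ) (σ τ : Memory) : Prop where
  reg : ∀ x, x ∉ R → τ.reg x = σ.reg x
  arr : ∀ a, a ∉ A → τ.arr a = σ.arr a

namespace SameExcept

variable {R A : List ℕ} {σ τ ρ : Memory}

theorem refl : SameExcept R A σ σ := ⟨fun _ _ => rfl, fun _ _ => rfl⟩

theorem setReg (h : SameExcept R A σ τ) {x : ℕ} (hx : x ∈ R) (v : ℕ) :
    SameExcept R A σ (τ.setReg x v) where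
  reg y hy := by rw [Memory.setReg_reg, if_neg (ne_of_mem_of_not_mem hx hy).symm, h.reg y hy]
  arr := h.arr

theorem setArr (h : SameExcept R A σ τ) {a : ℕ} (ha : a ∈ A) (i v : ℕ) :
    SameExcept R A σ (τ.setArr a i v) where
  reg := h.reg
  arr b hb := by
    rw [Memory.setArr_arr_of_ne _ _ _ (ne_of_mem_of_not_mem ha hb).symm, h.arr b hb]

theorem trans {R' A' : List ℕ} (h : SameExcept R A σ τ) (h' : SameExcept R' A' τ ρ)
    (hR : R' ⊆ R := by decide) (hA : A' ⊆ A := by decide) : SameExcept R A σ ρ where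
  reg x hx := (h'.reg x fun hx' => hx (hR hx')).trans (h.reg x hx)
  arr a ha := (h'.arr a fun ha' => ha (hA ha')).trans (h.arr a ha)

end SameExcept

/-- The data that stay fixed while the formula is processed: the degree `k`, the number of masks,
and tables of powers of two and of bit counts. -/
structure Tables (n k r : ℕ) (σ : Memory) : Prop where
  deg : σ.reg rDeg = k
  masks : σ.reg rMasks = 2 ^ k
  pow : ∀ m ≤ 2 * n * r * k + k, σ.arr aPow m = 2 ^ m
  count : ∀ m < 2 ^ k, σ.arr aCount m = popCount m

theorem Tables.of_sameExcept {n k r : ℕ} {R A : List ℕ} {σ τ : Memory} (h : Tables n k r σ)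
    (hστ : SameExcept R A σ τ) (hR : rDeg ∉ R ∧ rMasks ∉ R := by decide)
    (hA : aPow ∉ A ∧ aCount ∉ A := by decide) : Tables n k r τ where
  deg := (hστ.reg _ hR.1).trans h.deg
  masks := (hστ.reg _ hR.2).trans h.masks
  pow := hστ.arr _ hA.1 ▸ h.pow
  count := hστ.arr _ hA.2 ▸ h.count

/-- The node that is being processed: its source `u`, its sink `v` and its argument `x`, which is
the index of a variable or a fan-in. -/
structure CurrentNode (u v x : ℕ) (σ : Memory) : Prop where
  src : σ.reg rSrc = u
  sink : σ.reg rSink = v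
  arg : σ.reg rArg = x

theorem CurrentNode.of_sameExcept {u v x : ℕ} {R A : List ℕ} {σ τ : Memory}
    (h : CurrentNode u v x σ) (hστ : SameExcept R A σ τ)
    (hR : rSrc ∉ R ∧ rSink ∉ R ∧ rArg ∉ R := by decide) : CurrentNode u v x τ where
  src := (hστ.reg _ hR.1).trans h.src
  sink := (hστ.reg _ hR.2.1).trans h.sink
  arg := (hστ.reg _ hR.2.2).trans h.arg

/-- The memory holds the functions of states `V 0, V 1, …`, the values of the vertices, one after
another in a single array. -/
def HoldsValues (k : ℕ) (V : ℕ → ℕ → ℕ) (σ : Memory) : Prop :=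
  ∀ y X, X < dim k → σ.arr aVal (y * dim k + X) = V y X

theorem HoldsValues.of_sameExcept {k : ℕ} {V : ℕ → ℕ → ℕ} {R A : List ℕ} {σ τ : Memory}
    (h : HoldsValues k V σ) (hστ : SameExcept R A σ τ) (hA : aVal ∉ A := by decide) :
    HoldsValues k V τ := fun y X hX => by rw [hστ.arr _ hA, h y X hX]

theorem HoldsValues.add {k v Z : ℕ} {V : ℕ → ℕ → ℕ} {σ : Memory} (h : HoldsValues k V σ)
    (hZ : Z < dim k) (m : ℕ) :
    HoldsValues k (Function.update V v (V v + Pi.single Z m))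
      (σ.setArr aVal (v * dim k + Z) (V v Z + m)) := by
  intro y X hX
  have haddr : y * dim k + X = v * dim k + Z ↔ y = v ∧ X = Z := by
    refine ⟨fun heq => ?_, fun ⟨hy, hXZ⟩ => by rw [hy, hXZ]⟩
    have hy : y = v := by
      simpa [Nat.mul_add_div (dim_pos k), mul_comm _ (dim k), Nat.div_eq_of_lt hX,
        Nat.div_eq_of_lt hZ] using congrArg (· / dim k) heq
    exact ⟨hy, by rw [hy] at heq; omega⟩
  rw [Memory.setArr_arr, Function.update_apply, h y X hX]
  by_cases hy : y = v
  · by_cases hXZ : X = Z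
    · simp [hy, hXZ]
    · simp [hy, hXZ]
  · simp [haddr, hy]

/-! ### The program at a leaf -/

/-- The remainder of a division. -/
def Expr.mod (e f : Expr) : Expr := .sub e (.mul (.div e f) f)

theorem Expr.eval_mod (σ : Memory) (e f : Expr) : (e.mod f).eval σ = e.eval σ % f.eval σ :=
  Nat.mod_eq_sub_div_mul.symm

namespace Code

/-- Computes `dim k`. -/
def dim : Expr := .mul (.mul (.reg rMasks) (.reg rMasks)) (.const 2)

/-- Computes `transitions k r`. -/
def transitions (r : ℕ) : Expr := .mul (.mul (.mul dim (.reg rDeg)) (.reg rDeg)) (.const r)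

/-- Computes `stateAt k r c`, where `c` is the loop counter. -/
def stateAt (r : ℕ) : Expr := .div (.div (.div (.reg rCtr) (.const r)) (.reg rDeg)) (.reg rDeg)

/-- Computes `bitSAt k r c`. -/
def bitSAt (r : ℕ) : Expr := .mod (.div (.div (.reg rCtr) (.const r)) (.reg rDeg)) (.reg rDeg)

/-- Computes `bitTAt k r c`. -/
def bitTAt (r : ℕ) : Expr := .mod (.div (.reg rCtr) (.const r)) (.reg rDeg)

/-- Computes the first mask of the current state. -/
def maskS (r : ℕ) : Expr := .div (.div (stateAt r) (.const 2)) (.reg rMasks)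

/-- Computes the second mask of the current state. -/
def maskT (r : ℕ) : Expr := .mod (.div (stateAt r) (.const 2)) (.reg rMasks)

/-- Computes the part of the first mask from the current bit on. -/
def shiftS (r : ℕ) : Expr := .div (maskS r) (.load aPow (bitSAt r))

/-- Computes the part of the second mask from the current bit on. -/
def shiftT (r : ℕ) : Expr := .div (maskT r) (.load aPow (bitTAt r))

/-- Nonzero unless the current bits can be added to the masks of the current state. -/
def occupied (r : ℕ) : Expr := .add (.mod (shiftS r) (.const 2)) (.mod (shiftT r) (.const 2))

/-- Computes the state reached by the current transition. -/
def target (r : ℕ) : Expr :=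
  .add
    (.mul (.add (.mul (.add (maskS r) (.load aPow (bitSAt r))) (.reg rMasks))
      (.add (maskT r) (.load aPow (bitTAt r)))) (.const 2))
    (.mod (.add (.add (.load aCount (shiftS r)) (.load aCount (shiftT r)))
      (.mod (stateAt r) (.const 2))) (.const 2))

/-- Computes the coefficient of the current transition. -/
def coeff (r : ℕ) : Expr :=
  .load aPow (.mul (.add (.mul (.reg rArg) (.const r)) (.mod (.reg rCtr) (.const r)))
    (.add (bitSAt r) (bitTAt r)))

/-- The address of the entry for the state `e` in the value of the vertex in register `x`. -/
def address (x : ℕ) (e : Expr) : Expr := .add (.mul (.reg x) dim) e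

/-- Add one to the loop counter. -/
def incr : Program := .assign rCtr (.add (.reg rCtr) (.const 1))

/-- Carry out the current transition and go to the next one. -/
def transition (r : ℕ) : Program :=
  .seq
    (.cond (occupied r) .skip
      (.store aVal (address rSink (target r))
        (.add (.load aVal (address rSink (target r)))
          (.mul (coeff r) (.load aVal (address rSrc (stateAt r)))))))
    incr

/-- Add the value of the source, multiplied by the current variable, to the value of the sink. -/
def leaf (r : ℕ) : Program := .loop (.sub (transitions r) (.reg rCtr)) (transition r)

end Code

section Eval

variable {n k r u v i c : ℕ} {σ : Memory}

theorem eval_dim (hT : Tables n k r σ) : Code.dim.eval σ = dim k := by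
  simp only [Code.dim, Expr.eval, hT.masks, dim]

theorem eval_transitions (hT : Tables n k r σ) :
    (Code.transitions r).eval σ = transitions k r := by
  simp only [Code.transitions, Expr.eval, eval_dim hT, hT.deg, transitions]

theorem eval_stateAt (hT : Tables n k r σ) (hc : σ.reg rCtr = c) :
    (Code.stateAt r).eval σ = stateAt k r c := by
  simp only [Code.stateAt, Expr.eval, hT.deg, hc, stateAt]

theorem eval_bitSAt (hT : Tables n k r σ) (hc : σ.reg rCtr = c) :
    (Code.bitSAt r).eval σ = bitSAt k r c := by
  simp only [Code.bitSAt, Expr.eval_mod, Expr.eval, hT.deg, hc, bitSAt]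

theorem eval_bitTAt (hT : Tables n k r σ) (hc : σ.reg rCtr = c) :
    (Code.bitTAt r).eval σ = bitTAt k r c := by
  simp only [Code.bitTAt, Expr.eval_mod, Expr.eval, hT.deg, hc, bitTAt]

theorem eval_maskS (hT : Tables n k r σ) (hc : σ.reg rCtr = c) :
    (Code.maskS r).eval σ = maskS k (stateAt k r c) := by
  simp only [Code.maskS, Expr.eval, hT.masks, eval_stateAt hT hc, maskS]

theorem eval_maskT (hT : Tables n k r σ) (hc : σ.reg rCtr = c) :
    (Code.maskT r).eval σ = maskT k (stateAt k r c) := by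
  simp only [Code.maskT, Expr.eval_mod, Expr.eval, hT.masks, eval_stateAt hT hc, maskT]

theorem load_pow_bitSAt (hT : Tables n k r σ) (hc : σ.reg rCtr = c)
    (hlt : c < transitions k r) :
    (Expr.load aPow (Code.bitSAt r)).eval σ = 2 ^ bitSAt k r c := by
  simp only [Expr.eval, eval_bitSAt hT hc]
  exact hT.pow _ ((bitSAt_lt hlt).le.trans (Nat.le_add_left _ _))

theorem load_pow_bitTAt (hT : Tables n k r σ) (hc : σ.reg rCtr = c)
    (hlt : c < transitions k r) :
    (Expr.load aPow (Code.bitTAt r)).eval σ = 2 ^ bitTAt k r c := by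
  simp only [Expr.eval, eval_bitTAt hT hc]
  exact hT.pow _ ((bitTAt_lt hlt).le.trans (Nat.le_add_left _ _))

theorem eval_shiftS (hT : Tables n k r σ) (hc : σ.reg rCtr = c)
    (hlt : c < transitions k r) : (Code.shiftS r).eval σ =
      maskS k (stateAt k r c) / 2 ^ bitSAt k r c := by
  rw [Code.shiftS, Expr.eval, eval_maskS hT hc, load_pow_bitSAt hT hc hlt]

theorem eval_shiftT (hT : Tables n k r σ) (hc : σ.reg rCtr = c)
    (hlt : c < transitions k r) : (Code.shiftT r).eval σ =
      maskT k (stateAt k r c) / 2 ^ bitTAt k r c := by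
  rw [Code.shiftT, Expr.eval, eval_maskT hT hc, load_pow_bitTAt hT hc hlt]

theorem eval_occupied_eq_zero_iff (hT : Tables n k r σ) (hc : σ.reg rCtr = c)
    (hlt : c < transitions k r) : (Code.occupied r).eval σ = 0 ↔
      IsFree k (stateAt k r c) (bitSAt k r c) (bitTAt k r c) := by
  rw [Code.occupied, Expr.eval, Expr.eval_mod, Expr.eval_mod, eval_shiftS hT hc hlt,
    eval_shiftT hT hc hlt]
  exact Nat.add_eq_zero_iff

theorem eval_target (hT : Tables n k r σ) (hc : σ.reg rCtr = c)
    (hlt : c < transitions k r) : (Code.target r).eval σ =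
      target k (stateAt k r c) (bitSAt k r c) (bitTAt k r c) := by
  have hcountS := hT.count _ ((Nat.div_le_self _ (2 ^ bitSAt k r c)).trans_lt
    (maskS_lt (stateAt_lt hlt)))
  have hcountT := hT.count _ ((Nat.div_le_self _ (2 ^ bitTAt k r c)).trans_lt
    (maskT_lt k (stateAt k r c)))
  have hpowS := load_pow_bitSAt hT hc hlt
  have hpowT := load_pow_bitTAt hT hc hlt
  simp only [Expr.eval] at hpowS hpowT
  simp only [Code.target, Expr.eval, Expr.eval_mod, eval_maskS hT hc, eval_maskT hT hc, hpowS,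
    hpowT, hT.masks, eval_shiftS hT hc hlt, eval_shiftT hT hc hlt, hcountS, hcountT,
    eval_stateAt hT hc, target]

theorem eval_coeff (hT : Tables n k r σ) (hnode : CurrentNode u v i σ) (hi : i < n)
    (hc : σ.reg rCtr = c) (hlt : c < transitions k r) : (Code.coeff r).eval σ =
      2 ^ ((i * r + c % r) * (bitSAt k r c + bitTAt k r c)) := by
  simp only [Code.coeff, Expr.eval, Expr.eval_mod, hnode.arg, hc, eval_bitSAt hT hc,
    eval_bitTAt hT hc]
  exact hT.pow _ ((exponent_le hi hlt).trans (Nat.le_add_right _ _))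

end Eval

/-- The values of the vertices after the first `c` transitions of a leaf with source `u`, sink `v`
and variable `i`. -/
def partialLeaf (k r u v i : ℕ) (V : ℕ → ℕ → ℕ) (c : ℕ) : ℕ → ℕ → ℕ :=
  Function.update V v (V v + ∑ d ∈ Finset.range c, leafTerm k r i (V u) d)

section PartialLeaf

variable {n k r u v i c B : ℕ} {V : ℕ → ℕ → ℕ}

theorem partialLeaf_sink :
    partialLeaf k r u v i V c v = V v + ∑ d ∈ Finset.range c, leafTerm k r i (V u) d :=
  Function.update_self ..

theorem partialLeaf_of_ne {y : ℕ} (hy : y ≠ v) : partialLeaf k r u v i V c y = V y :=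
  Function.update_of_ne hy ..

theorem partialLeaf_zero : partialLeaf k r u v i V 0 = V := by
  rw [partialLeaf, Finset.range_zero, Finset.sum_empty, add_zero, Function.update_eq_self]

theorem partialLeaf_succ : partialLeaf k r u v i V (c + 1) =
    Function.update (partialLeaf k r u v i V c) v
      (partialLeaf k r u v i V c v + leafTerm k r i (V u) c) := by
  rw [partialLeaf_sink, partialLeaf, partialLeaf, Function.update_idem, Finset.sum_range_succ,
    add_assoc]

theorem partialLeaf_succ_of_not_isFree
    (h : ¬IsFree k (stateAt k r c) (bitSAt k r c) (bitTAt k r c)) :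
    partialLeaf k r u v i V (c + 1) = partialLeaf k r u v i V c := by
  rw [partialLeaf_succ, leafTerm, if_neg h, add_zero, Function.update_eq_self]

theorem partialLeaf_succ_of_isFree (h : IsFree k (stateAt k r c) (bitSAt k r c) (bitTAt k r c)) :
    partialLeaf k r u v i V (c + 1) = Function.update (partialLeaf k r u v i V c) v
      (partialLeaf k r u v i V c v +
        Pi.single (target k (stateAt k r c) (bitSAt k r c) (bitTAt k r c))
          (2 ^ ((i * r + c % r) * (bitSAt k r c + bitTAt k r c)) * V u (stateAt k r c))) := by
  rw [partialLeaf_succ, leafTerm, if_pos h]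

theorem partialLeaf_transitions : partialLeaf k r u v i V (transitions k r) =
    Function.update V v (V v + leafOp k r i (V u)) := by
  rw [partialLeaf, leafOp_eq_sum_leafTerm]

theorem partialLeaf_sink_le (hi : i < n) (hc : c ≤ transitions k r) (hV : ∀ y X, V y X ≤ B)
    (Z : ℕ) : partialLeaf k r u v i V c v Z ≤ B + transitions k r * (2 ^ (2 * n * r * k) * B) := by
  rw [partialLeaf_sink]
  exact add_le_add (hV v Z) (sum_leafTerm_le hi hc (hV u) Z)

end PartialLeaf

/-- The invariant of the loop of `Code.leaf`, started in `σ`, after `c` transitions. -/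
structure LeafInv (L k r u v i : ℕ) (V : ℕ → ℕ → ℕ) (σ : Memory) (c : ℕ) (τ : Memory) :
    Prop where
  bounded : Bounded L τ
  counter : τ.reg rCtr = c
  frame : SameExcept [rCtr] [aVal] σ τ
  values : HoldsValues k (partialLeaf k r u v i V c) τ

section RunsLeaf

variable {L n k r u v i c B : ℕ} {V : ℕ → ℕ → ℕ} {σ τ : Memory}

theorem LeafInv.runs_incr (hB : Bounded L τ) (hc : τ.reg rCtr = c)
    (hframe : SameExcept [rCtr] [aVal] σ τ)
    (hval : HoldsValues k (partialLeaf k r u v i V (c + 1)) τ) (hL : c + 1 < 2 ^ L) :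
    Runs L Code.incr τ 1 (LeafInv L k r u v i V σ (c + 1)) :=
  Runs.assign hB (v := c + 1) (by simp only [Expr.eval, hc])
    ⟨hB.setReg _ hL, by simp, hframe.setReg (by decide) _, hval⟩

theorem runs_transition (hT : Tables n k r σ) (hnode : CurrentNode u v i σ) (hi : i < n)
    (huv : u ≠ v) (hV : ∀ y X, V y X ≤ B) (htrans : transitions k r < 2 ^ L)
    (hL : B + transitions k r * (2 ^ (2 * n * r * k) * B) < 2 ^ L)
    (hlt : c < transitions k r) (h : LeafInv L k r u v i V σ c τ) :
    Runs L (Code.transition r) τ 3 (LeafInv L k r u v i V σ (c + 1)) := by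
  obtain ⟨hB, hc, hframe, hval⟩ := h
  replace hT := hT.of_sameExcept hframe
  replace hnode := hnode.of_sameExcept hframe
  have hincr : c + 1 < 2 ^ L := lt_of_le_of_lt hlt htrans
  have hX := stateAt_lt hlt
  refine Runs.seq (N := 2) (N' := 1) (Runs.cond hB (fun hne => ?_) fun h0 => ?_)
  · rw [Ne, eval_occupied_eq_zero_iff hT hc hlt] at hne
    refine Runs.skip hB.one_le (LeafInv.runs_incr hB hc hframe ?_ hincr)
    rwa [partialLeaf_succ_of_not_isFree hne]
  · have hfree := (eval_occupied_eq_zero_iff hT hc hlt).1 h0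
    have hZ := target_lt hX hfree (bitSAt_lt hlt) (bitTAt_lt hlt)
    set Z := target k (stateAt k r c) (bitSAt k r c) (bitTAt k r c)
    set m := 2 ^ ((i * r + c % r) * (bitSAt k r c + bitTAt k r c)) * V u (stateAt k r c)
    have hsucc := partialLeaf_succ_of_isFree (u := u) (v := v) (i := i) (V := V) hfree
    have hnew : partialLeaf k r u v i V (c + 1) v Z = partialLeaf k r u v i V c v Z + m := by
      rw [hsucc, Function.update_self, Pi.add_apply, Pi.single_eq_same]
    have hsource : τ.arr aVal (u * dim k + stateAt k r c) = V u (stateAt k r c) := by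
      rw [hval _ _ hX, partialLeaf_of_ne huv]
    have hval' := hval.add (v := v) hZ m
    rw [← hsucc] at hval'
    refine Runs.store (j := v * dim k + Z) (v := partialLeaf k r u v i V c v Z + m) hB ?_ ?_
      (LeafInv.runs_incr (hB.setArr _ _ ?_) hc (hframe.setArr (by decide) _ _) hval' hincr)
    · simp only [Expr.eval, Code.address, eval_dim hT, eval_target hT hc hlt, hnode.sink]
      rfl
    · simp only [Expr.eval, Code.address, eval_dim hT, eval_target hT hc hlt, hnode.sink,
        eval_stateAt hT hc, eval_coeff hT hnode hi hc hlt, hnode.src, hsource]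
      rw [hval _ _ hZ]
    · exact hnew ▸ (partialLeaf_sink_le hi hlt hV Z).trans_lt hL

theorem runs_leaf (hB : Bounded L σ) (hT : Tables n k r σ) (hnode : CurrentNode u v i σ)
    (h0 : σ.reg rCtr = 0) (hi : i < n) (huv : u ≠ v) (hval : HoldsValues k V σ)
    (hV : ∀ y X, V y X ≤ B) (htrans : transitions k r < 2 ^ L)
    (hL : B + transitions k r * (2 ^ (2 * n * r * k) * B) < 2 ^ L) :
    Runs L (Code.leaf r) σ (transitions k r * 4 + 1) fun τ => Bounded L τ ∧
      SameExcept [rCtr] [aVal] σ τ ∧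
      HoldsValues k (Function.update V v (V v + leafOp k r i (V u))) τ := by
  have heval {c : ℕ} {τ : Memory} (h : LeafInv L k r u v i V σ c τ) :
      (Expr.sub (Code.transitions r) (.reg rCtr)).eval τ = transitions k r - c := by
    simp only [Expr.eval, eval_transitions (hT.of_sameExcept h.frame), h.counter]
  refine (Runs.loop (LeafInv L k r u v i V σ) (fun c hc τ h => ?_) (fun τ h => ?_)
    ⟨hB, h0, .refl, partialLeaf_zero ▸ hval⟩).mono le_rfl fun τ h => ?_
  · exact ⟨h.bounded, by rw [heval h]; omega,
      runs_transition hT hnode hi huv hV htrans hL hc h⟩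
  · exact ⟨h.bounded, by rw [heval h, Nat.sub_self]⟩
  · exact ⟨h.bounded, h.frame, partialLeaf_transitions ▸ h.values⟩

end RunsLeaf

/-! ### Pending tasks -/

/-- An entry of the stack: the value of the vertex `source`, multiplied by `formula`, remains to be
added to the value of the vertex `sink`. -/
structure Task (n : ℕ) where
  formula : Formula n
  source : ℕ
  sink : ℕ

/-- The values of the vertices after all tasks, the last one first, have been carried out. -/
def process {n : ℕ} (k r : ℕ) (Δ : List (Task n)) (V : ℕ → ℕ → ℕ) : ℕ → ℕ → ℕ :=
  Δ.foldr (fun p V => Function.update V p.sink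
    (V p.sink + p.formula.evalIn (fun i : Fin n => leafOp k r i) (V p.source))) V

/-- The code of the formulas that are still pending. -/
def pendingCode {n : ℕ} (Δ : List (Task n)) : List ℕ :=
  (Δ.map fun p => p.formula.encode).flatten

section Pending

variable {n k r u v w : ℕ}

theorem process_append (Δ Δ' : List (Task n)) (V : ℕ → ℕ → ℕ) :
    process k r (Δ ++ Δ') V = process k r Δ (process k r Δ' V) :=
  List.foldr_append

theorem process_congr {Δ : List (Task n)} (hΔ : ∀ p ∈ Δ, p.source < w ∧ p.sink < w)
    {V V' : ℕ → ℕ → ℕ} (h : ∀ y < w, V y = V' y) :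
    ∀ y < w, process k r Δ V y = process k r Δ V' y := by
  induction Δ with
  | nil => exact h
  | cons p Δ ih =>
    obtain ⟨hsource, hsink⟩ := hΔ p List.mem_cons_self
    specialize ih fun p hp => hΔ p (List.mem_cons_of_mem _ hp)
    intro y hy
    simp only [process, List.foldr_cons] at ih ⊢
    rcases eq_or_ne y p.sink with rfl | hne
    · rw [Function.update_self, Function.update_self, ih _ hsource, ih _ hsink]
    · rw [Function.update_of_ne hne, Function.update_of_ne hne, ih _ hy]

theorem process_var (j : Fin n) (V : ℕ → ℕ → ℕ) :
    process k r [⟨.var j, u, v⟩] V = Function.update V v (V v + leafOp k r j (V u)) := by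
  simp only [process, List.foldr_cons, List.foldr_nil, Formula.evalIn]

theorem process_add (huv : u ≠ v) (l : List (Formula n)) (V : ℕ → ℕ → ℕ) :
    process k r (l.map fun φ => ⟨φ, u, v⟩) V = process k r [⟨.add l, u, v⟩] V := by
  induction l with
  | nil => simp [process, Formula.evalIn]
  | cons a l ih =>
    rw [List.map_cons, ← List.singleton_append, process_append, ih]
    simp only [process, List.foldr_cons, List.foldr_nil, Formula.evalIn, Function.update_self,
      Function.update_of_ne huv, Function.update_idem, List.map_cons, List.sum_cons]
    rw [add_assoc]
    exact congrArg (fun f => Function.update V v (V v + f)) (add_comm _ _)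

theorem process_mul (hv : v < w) (a b : Formula n) {V : ℕ → ℕ → ℕ} (hw : V w = 0) :
    ∀ y < w, process k r [⟨a, w, v⟩, ⟨b, u, w⟩] V y = process k r [⟨.mul a b, u, v⟩] V y := by
  intro y hy
  simp only [process, List.foldr_cons, List.foldr_nil, Formula.evalIn, Function.update_self,
    Function.update_of_ne hv.ne, hw, zero_add]
  rcases eq_or_ne y v with rfl | hne
  · rw [Function.update_self, Function.update_self]
    rfl
  · rw [Function.update_of_ne hne, Function.update_of_ne hne, Function.update_of_ne hy.ne]

end Pending

/-! ### Length of the code -/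

namespace Formula

variable {n : ℕ}

/-- The number of nodes of a formula, where a terminal node is counted wherever it is used. -/
def nodes : Formula n → ℕ
  | var _ => 1
  | add l => 1 + (l.map fun φ => φ.nodes).sum
  | mul a b => 1 + a.nodes + b.nodes

theorem nodes_pos (φ : Formula n) : 0 < φ.nodes := by
  cases φ <;> simp only [nodes] <;> omega

theorem length_encode (φ : Formula n) : φ.encode.length = 2 * φ.nodes := by
  induction φ using Formula.induction with
  | var i => simp only [encode, nodes, List.length_cons, List.length_nil]
  | add l ih =>
    simp only [encode, nodes, List.length_append, List.length_flatten, List.map_map,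
      Function.comp_def, List.map_congr_left ih, List.sum_map_mul_left, List.length_cons,
      List.length_nil]
    ring
  | mul a b iha ihb =>
    simp only [encode, nodes, List.length_append, iha, ihb, List.length_cons, List.length_nil]
    ring

theorem sum_nodes_le {l : List (Formula n)} {c : ℕ}
    (h : ∀ φ ∈ l, φ.nodes ≤ c * φ.size + φ.terminal?.toList.length) :
    (l.map fun φ => φ.nodes).sum ≤
      c * (l.map fun φ => φ.size).sum + (l.filterMap terminal?).length := by
  induction l with
  | nil => simp
  | cons a l ih =>
    have ha := h a List.mem_cons_self
    have hl := ih fun φ hφ => h φ (List.mem_cons_of_mem _ hφ)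
    have hlength : ((a :: l).filterMap terminal?).length =
        a.terminal?.toList.length + (l.filterMap terminal?).length := by
      rw [List.filterMap_cons]
      cases a.terminal? <;> simp [add_comm]
    simp only [List.map_cons, List.sum_cons, mul_add]
    omega

theorem nodes_le {φ : Formula n} (h : φ.IsSimple) :
    φ.nodes ≤ (n + 3) * φ.size + φ.terminal?.toList.length := by
  have hterminal (φ : Formula n) : φ.terminal?.toList.length ≤ 1 := by
    cases φ.terminal? <;> simp
  induction φ using Formula.induction with
  | var i => simp [nodes, terminal?]
  | add l ih =>
    rw [IsSimple] at h
    have hsum := sum_nodes_le fun φ hφ => ih φ hφ (h.2 φ hφ)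
    have hfan : (l.filterMap terminal?).length ≤ n := by simpa using h.1.length_le_card
    simp only [nodes, size, mul_add]
    omega
  | mul a b iha ihb =>
    rw [IsSimple] at h
    have ha := iha h.1
    have hb := ihb h.2
    simp only [nodes, size, mul_add]
    linarith [hterminal a, hterminal b]

theorem nodes_le_mul_max {φ : Formula n} (h : φ.IsSimple) :
    φ.nodes ≤ (n + 3) * max φ.size 1 := by
  have hle := nodes_le h
  cases φ with
  | var i => simp [nodes, size]
  | add l | mul a b => exact hle.trans (Nat.mul_le_mul_left _ (le_max_left _ _))

theorem length_le_sum_nodes (l : List (Formula n)) :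
    l.length ≤ (l.map fun φ => φ.nodes).sum := by
  simpa using List.length_le_sum_of_one_le (l.map fun φ => φ.nodes) fun m hm => by
    obtain ⟨φ, -, rfl⟩ := List.mem_map.1 hm
    exact φ.nodes_pos

theorem le_of_mem_encode (φ : Formula n) : ∀ x ∈ φ.encode, x ≤ n + φ.nodes + 1 := by
  induction φ using Formula.induction with
  | var i =>
    simpa [encode, nodes] using i.2.le.trans (by omega : n ≤ n + 1 + 1)
  | add l ih =>
    have hlength := length_le_sum_nodes l
    simp only [encode, nodes, List.forall_mem_append, List.mem_flatten, List.mem_map]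
    refine ⟨?_, List.forall_mem_cons.2 ⟨by omega, List.forall_mem_singleton.2 (by omega)⟩⟩
    rintro x ⟨_, ⟨φ, hφ, rfl⟩, hx⟩
    have hle : φ.nodes ≤ (l.map fun φ => φ.nodes).sum :=
      List.le_sum_of_mem (List.mem_map_of_mem hφ)
    exact (ih φ hφ x hx).trans (by omega)
  | mul a b iha ihb =>
    have ha := a.nodes_pos
    simp only [encode, nodes, List.forall_mem_append]
    exact ⟨⟨fun x hx => (iha x hx).trans (by omega), fun x hx => (ihb x hx).trans (by omega)⟩,
      List.forall_mem_cons.2 ⟨by omega, List.forall_mem_singleton.2 (by omega)⟩⟩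

end Formula

theorem length_le_length_pendingCode {n : ℕ} (Δ : List (Task n)) :
    2 * Δ.length ≤ (pendingCode Δ).length := by
  simp only [pendingCode, List.length_flatten, List.map_map, Function.comp_def,
    Formula.length_encode, List.sum_map_mul_left]
  have := Formula.length_le_sum_nodes (Δ.map Task.formula)
  simpa [Function.comp_def] using this

/-! ### The stack -/

/-- The memory holds the pending tasks, the last one on top of the stack. -/
structure HoldsTasks {n : ℕ} (Δ : List (Task n)) (σ : Memory) : Prop where
  top : σ.reg rTop = Δ.length
  entry : ∀ j p, Δ[j]? = some p → σ.arr aSrc j = p.source ∧ σ.arr aSink j = p.sink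

namespace Code

/-- Push a task whose source and sink are in the registers `x` and `y`. -/
def pushTask (x y : ℕ) : Program :=
  .seq (.store aSrc (.reg rTop) (.reg x)) (.seq (.store aSink (.reg rTop) (.reg y))
    (.assign rTop (.add (.reg rTop) (.const 1))))

/-- Push the summands of a sum. -/
def addGate : Program := .loop (.sub (.reg rArg) (.reg rCtr)) (.seq (pushTask rSrc rSink) incr)

/-- Push the two factors of a product, connected by a fresh vertex. -/
def mulGate : Program :=
  .seq (pushTask rFresh rSink) (.seq (pushTask rSrc rFresh)
    (.assign rFresh (.add (.reg rFresh) (.const 1))))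

end Code

section Stack

variable {n L : ℕ} {Δ : List (Task n)} {σ τ : Memory}

theorem HoldsTasks.of_sameExcept {R A : List ℕ} (h : HoldsTasks Δ σ) (hστ : SameExcept R A σ τ)
    (hR : rTop ∉ R := by decide) (hA : aSrc ∉ A ∧ aSink ∉ A := by decide) : HoldsTasks Δ τ where
  top := (hστ.reg _ hR).trans h.top
  entry := hστ.arr _ hA.1 ▸ hστ.arr _ hA.2 ▸ h.entry

theorem HoldsTasks.entry_top {p : Task n} (h : HoldsTasks (Δ ++ [p]) σ) :
    σ.arr aSrc Δ.length = p.source ∧ σ.arr aSink Δ.length = p.sink :=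
  h.entry _ _ List.getElem?_concat_length

theorem HoldsTasks.pop {p : Task n} (h : HoldsTasks (Δ ++ [p]) σ) (hA : τ.arr = σ.arr)
    (htop : τ.reg rTop = Δ.length) : HoldsTasks Δ τ where
  top := htop
  entry j q hj := hA ▸ h.entry j q
    (by rw [List.getElem?_append_left (List.getElem?_eq_some_iff.1 hj).1, hj])

theorem runs_pushTask (hB : Bounded L σ) (h : HoldsTasks Δ σ) (hL : Δ.length + 1 < 2 ^ L)
    (p : Task n) {x y : ℕ} (hx : σ.reg x = p.source) (hy : σ.reg y = p.sink) :
    Runs L (Code.pushTask x y) σ 3 fun τ =>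
      Bounded L τ ∧ SameExcept [rTop] [aSrc, aSink] σ τ ∧ HoldsTasks (Δ ++ [p]) τ := by
  refine Runs.store_seq (N := 2) hB h.top hx (hx ▸ hB.reg_lt x) fun hB => ?_
  refine Runs.store_seq (N := 1) hB h.top hy (hy ▸ hB.reg_lt y) fun hB => ?_
  refine Runs.assign hB (v := Δ.length + 1) (by simp only [Expr.eval, Memory.setArr_reg, h.top])
    ⟨hB.setReg _ hL, ((SameExcept.refl.setArr (by decide) _ _).setArr (by decide) _ _).setReg
      (by decide) _, by simp, fun j q hj => ?_⟩
  simp only [Memory.setReg_arr, Memory.setArr_arr]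
  have hle : j ≤ Δ.length := by simpa using (List.getElem?_eq_some_iff.1 hj).1
  rcases hle.lt_or_eq with hlt | rfl
  · rw [List.getElem?_append_left hlt] at hj
    simpa [hlt.ne] using h.entry j q hj
  · rw [List.getElem?_concat_length, Option.some_inj] at hj
    simp [← hj]

theorem runs_addGate {u v : ℕ} (hB : Bounded L σ) (h : HoldsTasks Δ σ) (l : List (Formula n))
    (hnode : CurrentNode u v l.length σ) (h0 : σ.reg rCtr = 0)
    (hL : Δ.length + l.length < 2 ^ L) :
    Runs L Code.addGate σ (l.length * 5 + 1) fun τ => Bounded L τ ∧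
      SameExcept [rTop, rCtr] [aSrc, aSink] σ τ ∧ HoldsTasks (Δ ++ l.map (⟨·, u, v⟩)) τ := by
  have hbody : ∀ c < l.length, ∀ τ, Bounded L τ ∧ τ.reg rCtr = c ∧
      SameExcept [rTop, rCtr] [aSrc, aSink] σ τ ∧
      HoldsTasks (Δ ++ (l.take c).map (⟨·, u, v⟩)) τ →
      Bounded L τ ∧ (Expr.sub (.reg rArg) (.reg rCtr)).eval τ ≠ 0 ∧
      Runs L (.seq (Code.pushTask rSrc rSink) Code.incr) τ (3 + 1) fun ρ => Bounded L ρ ∧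
        ρ.reg rCtr = c + 1 ∧ SameExcept [rTop, rCtr] [aSrc, aSink] σ ρ ∧
        HoldsTasks (Δ ++ (l.take (c + 1)).map (⟨·, u, v⟩)) ρ := by
    rintro c hc τ ⟨hB, hctr, hsame, h⟩
    have hnode := hnode.of_sameExcept hsame
    refine ⟨hB, by simp only [Expr.eval, hnode.arg, hctr]; omega, Runs.seq ?_⟩
    have hroom : (Δ ++ (l.take c).map (⟨·, u, v⟩ : Formula n → Task n)).length + 1 < 2 ^ L := by
      rw [List.length_append, List.length_map, List.length_take]
      omega
    refine (runs_pushTask hB h hroom ⟨l[c], u, v⟩ hnode.src hnode.sink).mono le_rfl ?_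
    rintro ρ ⟨hB, hpush, h⟩
    refine Runs.assign hB (v := c + 1)
      (by simp only [Expr.eval, hpush.reg rCtr (by decide), hctr])
      ⟨hB.setReg _ (by omega), by simp, (hsame.trans hpush).setReg (by decide) _, ?_⟩
    rw [List.append_assoc, ← List.map_singleton (f := (⟨·, u, v⟩ : Formula n → Task n)),
      ← List.map_append, List.take_concat_get'] at h
    exact h.of_sameExcept (SameExcept.refl.setReg (R := [rCtr]) (A := []) (by decide) _)
  refine (Runs.loop _ hbody ?_ ⟨hB, h0, .refl, by simpa using h⟩).mono le_rfl ?_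
  · rintro τ ⟨hB, hctr, hsame, -⟩
    exact ⟨hB, by simp only [Expr.eval, (hnode.of_sameExcept hsame).arg, hctr, Nat.sub_self]⟩
  · rintro τ ⟨hB, -, hsame, h⟩
    exact ⟨hB, hsame, by rwa [List.take_length] at h⟩

theorem runs_mulGate {u v w : ℕ} (hB : Bounded L σ) (h : HoldsTasks Δ σ) (a b : Formula n)
    {x : ℕ} (hnode : CurrentNode u v x σ) (hw : σ.reg rFresh = w) (hL : Δ.length + 2 < 2 ^ L)
    (hwL : w + 1 < 2 ^ L) :
    Runs L Code.mulGate σ 7 fun τ => Bounded L τ ∧ τ.reg rFresh = w + 1 ∧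
      SameExcept [rTop, rFresh] [aSrc, aSink] σ τ ∧
      HoldsTasks (Δ ++ [⟨a, w, v⟩, ⟨b, u, w⟩]) τ := by
  refine Runs.seq (N := 3) (N' := 4)
    ((runs_pushTask hB h (by omega) ⟨a, w, v⟩ hw hnode.sink).mono le_rfl ?_)
  rintro τ ⟨hB, hsame, h⟩
  have hw' : τ.reg rFresh = w := (hsame.reg rFresh (by decide)).trans hw
  refine Runs.seq (N := 3) (N' := 1) ((runs_pushTask hB h (by rwa [List.length_append]) ⟨b, u, w⟩
    (hnode.of_sameExcept hsame).src hw').mono le_rfl ?_)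
  rintro ρ ⟨hB, hsame', h⟩
  refine Runs.assign hB (v := w + 1)
    (by simp only [Expr.eval, hsame'.reg rFresh (by decide), hw'])
    ⟨hB.setReg _ hwL, by simp,
      ((SameExcept.refl.trans hsame).trans hsame').setReg (by decide) _, ?_⟩
  rw [List.append_assoc] at h
  exact h.of_sameExcept (SameExcept.refl.setReg (R := [rFresh]) (A := []) (by decide) _)

end Stack

/-! ### Progress -/

/-- A stage of the evaluation: the pending tasks, the values of the vertices, and the least vertex
that has not been used yet. -/
structure Config (n : ℕ) where
  tasks : List (Task n)
  values : ℕ → ℕ → ℕ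
  fresh : ℕ

/-- The invariant of the evaluation of `φ` after `i` nodes have been processed: to carry out the
pending tasks turns the value of vertex `1` into the image of the initial state under `φ`, their
code is what remains of the code of `φ`, and values grow by at most `g` bits per node. -/
structure Progress {n : ℕ} (k r g : ℕ) (φ : Formula n) (i : ℕ) (c : Config n) : Prop where
  length : (pendingCode c.tasks).length + 2 * i = 2 * φ.nodes
  isPrefix : pendingCode c.tasks <+: φ.encode
  two_le : 2 ≤ c.fresh
  fresh_le : c.fresh ≤ i + 2
  vertices : ∀ p ∈ c.tasks, p.source < c.fresh ∧ p.sink < c.fresh ∧ p.source ≠ p.sink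
  unused : ∀ y, c.fresh ≤ y → c.values y = 0
  value_le : ∀ y X, c.values y X ≤ 2 ^ (g * i)
  value : process k r c.tasks c.values 1 =
    φ.evalIn (fun i : Fin n => leafOp k r i) (Pi.single 0 1)

section Progress

variable {n k r g i w w' u v : ℕ} {φ ψ : Formula n} {c : Config n} {Δ Δ' : List (Task n)}
  {p : Task n} {V V' : ℕ → ℕ → ℕ}

theorem pendingCode_append (Δ Δ' : List (Task n)) :
    pendingCode (Δ ++ Δ') = pendingCode Δ ++ pendingCode Δ' := by
  simp only [pendingCode, List.map_append, List.flatten_append]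

theorem pendingCode_singleton (p : Task n) : pendingCode [p] = p.formula.encode := by
  simp [pendingCode]

theorem Progress.length_le (h : Progress k r g φ i c) : c.tasks.length + i ≤ φ.nodes := by
  linarith [h.length, length_le_length_pendingCode c.tasks]

theorem Progress.exists_eq_append (h : Progress k r g φ i c) (hi : i < φ.nodes) :
    ∃ Δ p, c.tasks = Δ ++ [p] := by
  rcases List.eq_nil_or_concat' c.tasks with hnil | hcons
  · have hlength := h.length
    simp only [hnil, pendingCode, List.map_nil, List.flatten_nil, List.length_nil] at hlength
    omega
  · exact hcons

theorem Progress.vertices_top (h : Progress k r g φ i ⟨Δ ++ [p], V, w⟩) :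
    p.source < w ∧ p.sink < w ∧ p.source ≠ p.sink :=
  h.vertices p (List.mem_append_right _ (List.mem_singleton_self p))

theorem Progress.replace (h : Progress k r g φ i ⟨Δ ++ [p], V, w⟩) {kind x : ℕ}
    (hcode : p.formula.encode = pendingCode Δ' ++ [kind, x]) (hle : w ≤ w') (hle' : w' ≤ w + 1)
    (hΔ' : ∀ q ∈ Δ', q.source < w' ∧ q.sink < w' ∧ q.source ≠ q.sink)
    (hunused : ∀ y, w' ≤ y → V' y = 0) (hV' : ∀ y X, V' y X ≤ 2 ^ (g * (i + 1)))
    (hvalue : ∀ y < w, process k r Δ' V' y = process k r [p] V y) :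
    Progress k r g φ (i + 1) ⟨Δ ++ Δ', V', w'⟩ where
  length := by
    have hlength := h.length
    simp only [pendingCode_append, pendingCode_singleton, hcode, List.length_append,
      List.length_cons, List.length_nil] at hlength ⊢
    omega
  isPrefix := by
    have hprefix := h.isPrefix
    simp only [pendingCode_append, pendingCode_singleton, hcode, ← List.append_assoc]
      at hprefix ⊢
    exact (List.prefix_append _ _).trans hprefix
  two_le := h.two_le.trans hle
  fresh_le := by
    have hfresh := h.fresh_le
    simp only at hfresh ⊢
    omega
  vertices q hq := by
    rcases List.mem_append.1 hq with hq | hq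
    · obtain ⟨hsource, hsink, hne⟩ := h.vertices q (List.mem_append_left _ hq)
      exact ⟨hsource.trans_le hle, hsink.trans_le hle, hne⟩
    · exact hΔ' q hq
  unused := hunused
  value_le := hV'
  value := by
    rw [← h.value, process_append, process_append]
    refine process_congr (fun q hq => ?_) hvalue 1 h.two_le
    obtain ⟨hsource, hsink, -⟩ := h.vertices q (List.mem_append_left _ hq)
    exact ⟨hsource, hsink⟩

theorem Progress.value_le_succ (h : Progress k r g φ i c) (y X : ℕ) :
    c.values y X ≤ 2 ^ (g * (i + 1)) :=
  (h.value_le y X).trans (Nat.pow_le_pow_right two_pos (Nat.mul_le_mul_left _ (Nat.le_succ i)))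

theorem Progress.add {l : List (Formula n)}
    (h : Progress k r g φ i ⟨Δ ++ [⟨.add l, u, v⟩], V, w⟩) :
    Progress k r g φ (i + 1) ⟨Δ ++ l.map (⟨·, u, v⟩), V, w⟩ := by
  obtain ⟨hu, hv, huv⟩ := h.vertices_top
  refine h.replace (kind := 1) (x := l.length) ?_ le_rfl (Nat.le_succ w) ?_ h.unused
    h.value_le_succ fun y _ => by rw [process_add huv]
  · simp [Formula.encode, pendingCode, Function.comp_def]
  · rintro q hq
    obtain ⟨ψ, -, rfl⟩ := List.mem_map.1 hq
    exact ⟨hu, hv, huv⟩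

theorem Progress.mul {a b : Formula n}
    (h : Progress k r g φ i ⟨Δ ++ [⟨.mul a b, u, v⟩], V, w⟩) :
    Progress k r g φ (i + 1) ⟨Δ ++ [⟨a, w, v⟩, ⟨b, u, w⟩], V, w + 1⟩ := by
  obtain ⟨hu, hv, -⟩ := h.vertices_top
  refine h.replace (kind := 2) (x := 2) ?_ (Nat.le_succ w) le_rfl ?_
    (fun y hy => h.unused y ((Nat.le_succ w).trans hy)) h.value_le_succ
    (process_mul hv a b (h.unused w le_rfl))
  · simp [Formula.encode, pendingCode]
  · simp only [List.forall_mem_cons, List.not_mem_nil, false_imp_iff, implies_true, and_true]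
    have hv' := hv.trans (Nat.lt_succ_self w)
    exact ⟨⟨Nat.lt_succ_self w, hv', hv.ne'⟩, hu.trans (Nat.lt_succ_self w),
      Nat.lt_succ_self w, hu.ne⟩

/-- The bounds under which a run on a formula with `N` nodes stays within `L` bits, if values grow
by at most `g` bits per node. -/
structure Fits (n k r N g L : ℕ) : Prop where
  growth : 1 + transitions k r * 2 ^ (2 * n * r * k) ≤ 2 ^ g
  values : g * N < L
  transitions_lt : transitions k r < 2 ^ L
  stack : 2 * N + 3 < 2 ^ L

theorem Fits.value_growth {N L : ℕ} (h : Fits n k r N g L) (i : ℕ) :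
    2 ^ (g * i) + transitions k r * (2 ^ (2 * n * r * k) * 2 ^ (g * i)) ≤ 2 ^ (g * (i + 1)) :=
  calc _ = (1 + transitions k r * 2 ^ (2 * n * r * k)) * 2 ^ (g * i) := by ring
    _ ≤ 2 ^ g * 2 ^ (g * i) := Nat.mul_le_mul_right _ h.growth
    _ = 2 ^ (g * (i + 1)) := by ring

theorem Fits.pow_lt {N L : ℕ} (h : Fits n k r N g L) (hi : i ≤ N) : 2 ^ (g * i) < 2 ^ L :=
  Nat.pow_lt_pow_right one_lt_two ((Nat.mul_le_mul_left g hi).trans_lt h.values)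

theorem Progress.var {N L : ℕ} (hF : Fits n k r N g L) {j : Fin n}
    (h : Progress k r g φ i ⟨Δ ++ [⟨.var j, u, v⟩], V, w⟩) :
    Progress k r g φ (i + 1) ⟨Δ, Function.update V v (V v + leafOp k r j (V u)), w⟩ := by
  obtain ⟨-, hv, -⟩ := h.vertices_top
  rw [← List.append_nil Δ]
  refine h.replace (kind := 0) (x := j) (by simp [Formula.encode, pendingCode]) le_rfl
    (Nat.le_succ w) (by simp) (fun y hy => ?_) (fun y X => ?_) fun y _ => by rw [process_var]; rfl
  · rw [Function.update_of_ne (hv.trans_le hy).ne']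
    exact h.unused y hy
  · rcases eq_or_ne y v with rfl | hne
    · have hle := partialLeaf_sink_le (k := k) (r := r) (u := u) (v := y) j.2 le_rfl
        h.value_le X
      rw [partialLeaf_transitions] at hle
      exact hle.trans (hF.value_growth i)
    · rw [Function.update_of_ne hne]
      exact h.value_le_succ y X

end Progress

/-! ### Processing one node -/

/-- The memory represents the stage `c` of the evaluation of `φ` after `i` nodes. -/
structure Represents {n : ℕ} (L k r : ℕ) (φ : Formula n) (i : ℕ) (c : Config n) (σ : Memory) :
    Prop where
  bounded : Bounded L σ
  tables : Tables n k r σ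
  code : ∀ j, σ.arr aCode j = φ.encode.getD j 0
  position : σ.reg rPos + 2 * i = 2 * φ.nodes
  tasks : HoldsTasks c.tasks σ
  values : HoldsValues k c.values σ
  fresh : σ.reg rFresh = c.fresh

namespace Code

/-- Pop the stack and read the next node. -/
def fetch : Program :=
  .seq (.assign rPos (.sub (.reg rPos) (.const 2)))
    (.seq (.assign rTop (.sub (.reg rTop) (.const 1)))
    (.seq (.assign rSrc (.load aSrc (.reg rTop)))
    (.seq (.assign rSink (.load aSink (.reg rTop)))
    (.seq (.assign rArg (.load aCode (.add (.reg rPos) (.const 1))))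
    (.assign rCtr (.const 0))))))

/-- The kind of the current node: `0` for a variable, `1` for a sum, `2` for a product. -/
def kind : Expr := .load aCode (.reg rPos)

/-- Handle one node of the formula. -/
def node (r : ℕ) : Program :=
  .seq fetch (.cond kind (.cond (.sub kind (.const 1)) mulGate addGate) (leaf r))

end Code

section RunsNode

variable {n L k r g i u v w x kind : ℕ} {φ ψ : Formula n} {Δ : List (Task n)} {p : Task n}
  {V : ℕ → ℕ → ℕ} {c : Config n} {σ : Memory} {pre : List ℕ}

theorem getD_length_of_isPrefix {a b : ℕ} {l : List ℕ} (h : pre ++ [a, b] <+: l) :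
    l.getD pre.length 0 = a ∧ l.getD (pre.length + 1) 0 = b := by
  obtain ⟨t, rfl⟩ := h
  constructor <;> simp [List.getD_eq_getElem?_getD]

theorem Represents.code_top (h : Represents L k r φ i ⟨Δ ++ [p], V, w⟩ σ)
    (hp : Progress k r g φ i ⟨Δ ++ [p], V, w⟩) (hcode : p.formula.encode = pre ++ [kind, x]) :
    σ.arr aCode (σ.reg rPos - 2) = kind ∧ σ.arr aCode (σ.reg rPos - 2 + 1) = x := by
  have hlength := hp.length
  have hprefix := hp.isPrefix
  simp only [pendingCode_append, pendingCode_singleton, hcode, ← List.append_assoc]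
    at hlength hprefix
  have hposition := h.position
  have hpos : σ.reg rPos - 2 = (pendingCode Δ ++ pre).length := by
    simp only [List.length_append, List.length_cons, List.length_nil] at hlength ⊢
    omega
  rw [h.code, h.code, hpos]
  exact getD_length_of_isPrefix hprefix

theorem runs_fetch (h : Represents L k r φ i ⟨Δ ++ [p], V, w⟩ σ)
    (hp : Progress k r g φ i ⟨Δ ++ [p], V, w⟩) (hi : i < φ.nodes)
    (hcode : p.formula.encode = pre ++ [kind, x]) :
    Runs L Code.fetch σ 6 fun τ => Represents L k r φ (i + 1) ⟨Δ, V, w⟩ τ ∧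
      CurrentNode p.source p.sink x τ ∧ τ.reg rCtr = 0 ∧ Code.kind.eval τ = kind := by
  obtain ⟨hkind, hx⟩ := h.code_top hp hcode
  obtain ⟨hsource, hsink⟩ := h.tasks.entry_top
  obtain ⟨hB, hT, hφ, hposition, hΔ, hV, hw⟩ := h
  have htop : σ.reg rTop = Δ.length + 1 := by simpa using hΔ.top
  have hltPos := hB.reg_lt rPos
  have hltTop := hB.reg_lt rTop
  have hltSource := hsource ▸ hB.arr_lt aSrc Δ.length
  have hltSink := hsink ▸ hB.arr_lt aSink Δ.length
  have hltArg := hx ▸ hB.arr_lt aCode _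
  refine Runs.assign_seq (N := 5) hB (v := σ.reg rPos - 2) rfl (by omega) fun hB => ?_
  refine Runs.assign_seq (N := 4) hB (v := Δ.length) (by simp [Expr.eval, htop]) (by omega)
    fun hB => ?_
  refine Runs.assign_seq (N := 3) hB (by simp [Expr.eval, hsource]) hltSource fun hB => ?_
  refine Runs.assign_seq (N := 2) hB (by simp [Expr.eval, hsink]) hltSink fun hB => ?_
  refine Runs.assign_seq (N := 1) hB (by simp [Expr.eval, hx]) hltArg fun hB => ?_
  have hsame : SameExcept [rPos, rTop, rSrc, rSink, rArg, rCtr] [] σ _ :=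
    (((((SameExcept.refl.setReg (x := rPos) (by decide) (σ.reg rPos - 2)).setReg (x := rTop)
      (by decide) Δ.length).setReg (x := rSrc) (by decide) p.source).setReg (x := rSink)
      (by decide) p.sink).setReg (x := rArg) (by decide) x).setReg (x := rCtr) (by decide) 0
  refine Runs.assign hB (v := 0) rfl ⟨⟨hB.setReg _ (by positivity), hT.of_sameExcept hsame, hφ,
    ?_, hΔ.pop rfl (by simp), hV, by simpa using hw⟩, ⟨by simp, by simp, by simp⟩, by simp, ?_⟩
  · simp only [Memory.setReg_reg, Nat.reduceEqDiff, ↓reduceIte]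
    omega
  · simp [Code.kind, Expr.eval, hkind]

theorem Represents.of_sameExcept {R A : List ℕ} {τ : Memory} {c' : Config n}
    (h : Represents L k r φ i c σ) (hB : Bounded L τ) (hστ : SameExcept R A σ τ)
    (htasks : HoldsTasks c'.tasks τ) (hvalues : HoldsValues k c'.values τ)
    (hfresh : τ.reg rFresh = c'.fresh)
    (hR : rDeg ∉ R ∧ rMasks ∉ R ∧ rPos ∉ R := by decide)
    (hA : aPow ∉ A ∧ aCount ∉ A ∧ aCode ∉ A := by decide) : Represents L k r φ i c' τ where
  bounded := hB
  tables := h.tables.of_sameExcept hστ ⟨hR.1, hR.2.1⟩ ⟨hA.1, hA.2.1⟩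
  code := hστ.arr _ hA.2.2 ▸ h.code
  position := hστ.reg _ hR.2.2 ▸ h.position
  tasks := htasks
  values := hvalues
  fresh := hfresh

/-- The number of steps to process a node of a formula with `N` nodes. -/
def nodeSteps (k r N : ℕ) : ℕ := 6 + (transitions k r * 4 + 10 * N + 10)

theorem runs_node_var (hF : Fits n k r φ.nodes g L) (hi : i < φ.nodes) {j : Fin n}
    (h : Represents L k r φ i ⟨Δ ++ [⟨.var j, u, v⟩], V, w⟩ σ)
    (hp : Progress k r g φ i ⟨Δ ++ [⟨.var j, u, v⟩], V, w⟩) :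
    Runs L (Code.node r) σ (nodeSteps k r φ.nodes) fun τ =>
      Represents L k r φ (i + 1) ⟨Δ, Function.update V v (V v + leafOp k r j (V u)), w⟩ τ := by
  refine Runs.seq ((runs_fetch h hp hi (pre := []) (kind := 0) (x := j)
    (by simp [Formula.encode])).mono le_rfl ?_)
  rintro τ ⟨h, hnode, h0, hkind⟩
  have hlt := (hF.value_growth i).trans_lt (hF.pow_lt hi)
  refine (Runs.cond h.bounded (fun hne => absurd hkind hne) fun _ =>
    runs_leaf h.bounded h.tables hnode h0 j.2 hp.vertices_top.2.2 h.values hp.value_le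
      hF.transitions_lt hlt).mono (by omega) ?_
  rintro ρ ⟨hB, hsame, hV⟩
  exact h.of_sameExcept hB hsame (h.tasks.of_sameExcept hsame) hV
    ((hsame.reg _ (by decide)).trans h.fresh)

theorem runs_node_add (hF : Fits n k r φ.nodes g L) (hi : i < φ.nodes) {l : List (Formula n)}
    (h : Represents L k r φ i ⟨Δ ++ [⟨.add l, u, v⟩], V, w⟩ σ)
    (hp : Progress k r g φ i ⟨Δ ++ [⟨.add l, u, v⟩], V, w⟩) :
    Runs L (Code.node r) σ (nodeSteps k r φ.nodes) fun τ =>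
      Represents L k r φ (i + 1) ⟨Δ ++ l.map (⟨·, u, v⟩), V, w⟩ τ := by
  refine Runs.seq ((runs_fetch h hp hi (kind := 1) (x := l.length)
    (by rw [Formula.encode])).mono le_rfl ?_)
  rintro τ ⟨h, hnode, h0, hkind⟩
  have hlength := hp.add.length_le
  have hstack := hF.stack
  simp only [List.length_append, List.length_map] at hlength
  refine (Runs.cond h.bounded (fun _ => Runs.cond h.bounded (fun hne => ?_) fun _ =>
    runs_addGate h.bounded h.tasks l hnode h0 (by simp only; omega)) fun h0 => ?_).mono
      (by omega) ?_
  · simp [Expr.eval, hkind] at hne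
  · simp [hkind] at h0
  rintro ρ ⟨hB, hsame, hΔ⟩
  exact h.of_sameExcept hB hsame hΔ (h.values.of_sameExcept hsame)
    ((hsame.reg _ (by decide)).trans h.fresh)

theorem runs_node_mul (hF : Fits n k r φ.nodes g L) (hi : i < φ.nodes) {a b : Formula n}
    (h : Represents L k r φ i ⟨Δ ++ [⟨.mul a b, u, v⟩], V, w⟩ σ)
    (hp : Progress k r g φ i ⟨Δ ++ [⟨.mul a b, u, v⟩], V, w⟩) :
    Runs L (Code.node r) σ (nodeSteps k r φ.nodes) fun τ =>
      Represents L k r φ (i + 1) ⟨Δ ++ [⟨a, w, v⟩, ⟨b, u, w⟩], V, w + 1⟩ τ := by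
  refine Runs.seq ((runs_fetch h hp hi (kind := 2) (x := 2)
    (by rw [Formula.encode])).mono le_rfl ?_)
  rintro τ ⟨h, hnode, -, hkind⟩
  have hlength := hp.mul.length_le
  have hfresh := hp.fresh_le
  have hstack := hF.stack
  simp only [List.length_append, List.length_cons, List.length_nil] at hlength hfresh
  refine (Runs.cond h.bounded (fun _ => Runs.cond h.bounded (fun _ =>
    runs_mulGate h.bounded h.tasks a b hnode h.fresh (by simp only; omega) (by simp only; omega))
    fun h0 => ?_) fun h0 => ?_).mono (by omega) ?_
  · simp [Expr.eval, hkind] at h0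
  · simp [hkind] at h0
  rintro ρ ⟨hB, hfresh, hsame, hΔ⟩
  exact h.of_sameExcept hB hsame hΔ (h.values.of_sameExcept hsame) hfresh

theorem runs_node (hF : Fits n k r φ.nodes g L) (hi : i < φ.nodes)
    (h : Represents L k r φ i c σ) (hp : Progress k r g φ i c) :
    Runs L (Code.node r) σ (nodeSteps k r φ.nodes) fun τ =>
      ∃ c', Represents L k r φ (i + 1) c' τ ∧ Progress k r g φ (i + 1) c' := by
  obtain ⟨Δ, ⟨ψ, u, v⟩, htasks⟩ := hp.exists_eq_append hi
  obtain ⟨_, V, w⟩ := c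
  obtain rfl := htasks
  cases ψ with
  | var j => exact (runs_node_var hF hi h hp).mono le_rfl fun τ h => ⟨_, h, hp.var hF⟩
  | add l => exact (runs_node_add hF hi h hp).mono le_rfl fun τ h => ⟨_, h, hp.add⟩
  | mul a b => exact (runs_node_mul hF hi h hp).mono le_rfl fun τ h => ⟨_, h, hp.mul⟩

end RunsNode

/-! ### The whole program -/

namespace Code

/-- Tabulate the powers of two. -/
def powTable (r : ℕ) : Program :=
  .loop (.sub (.add (.mul (.mul (.mul (.const 2) (.reg 0)) (.const r)) (.reg rDeg)) (.reg rDeg))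
      (.reg rCtr))
    (.seq (.store aPow (.add (.reg rCtr) (.const 1)) (.mul (.load aPow (.reg rCtr)) (.const 2)))
      incr)

/-- Tabulate the bit counts of the masks. -/
def countTable : Program :=
  .loop (.sub (.reg rMasks) (.reg rCtr))
    (.seq (.store aCount (.reg rCtr)
      (.add (.load aCount (.div (.reg rCtr) (.const 2))) (.mod (.reg rCtr) (.const 2)))) incr)

/-- Set up the data described by `Tables`. -/
def tables (r : ℕ) : Program :=
  .seq (.store aPow (.const 0) (.const 1))
    (.seq (powTable r)
    (.seq (.assign rMasks (.load aPow (.reg rDeg)))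
    (.seq (.assign rCtr (.const 0)) countTable)))

/-- Set up the initial stage. The source of the only task, vertex `0`, need not be written. -/
def initial : Program :=
  .seq (.store aVal (.const 0) (.const 1))
    (.seq (.store aSink (.const 0) (.const 1))
    (.seq (.assign rTop (.const 1)) (.assign rFresh (.const 2))))

/-- Compare the entries of vertex `1` for the two top states. -/
def answer : Program :=
  .cond (.sub (.load aVal (.add dim (.sub dim (.const 2))))
      (.load aVal (.add dim (.sub dim (.const 1)))))
    (.assign 0 (.const 1)) (.assign 0 (.const 0))

/-- The program that detects monomials of degree `k` with exponents at most `r`. -/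
def full (r : ℕ) : Program :=
  .seq (tables r) (.seq initial (.seq (.loop (.reg rPos) (node r)) answer))

end Code

/-- The initial stage of the evaluation of `φ`: vertex `0` holds the initial state, and its image
under `φ` is to be added to vertex `1`. -/
def Config.initial {n : ℕ} (φ : Formula n) : Config n :=
  ⟨[⟨φ, 0, 1⟩], Pi.single 0 (Pi.single 0 1), 2⟩

section RunsFull

variable {n k r g L : ℕ} {φ : Formula n} {V : ℕ → ℕ → ℕ} {σ : Memory}

theorem runs_powTable (hB : Bounded L σ) (hn : σ.reg 0 = n) (hk : σ.reg rDeg = k)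
    (hctr : σ.reg rCtr = 0) (h0 : σ.arr aPow 0 = 1) (hL : 2 * n * r * k + k < L) :
    Runs L (Code.powTable r) σ ((2 * n * r * k + k) * 3 + 1) fun τ => Bounded L τ ∧
      SameExcept [rCtr] [aPow] σ τ ∧ ∀ m ≤ 2 * n * r * k + k, τ.arr aPow m = 2 ^ m := by
  refine (Runs.loop (N := 2) (fun c τ => Bounded L τ ∧ τ.reg rCtr = c ∧
    SameExcept [rCtr] [aPow] σ τ ∧ ∀ m ≤ c, τ.arr aPow m = 2 ^ m) ?_ ?_
    ⟨hB, hctr, .refl, fun m hm => by rw [Nat.le_zero.1 hm, h0, pow_zero]⟩).mono le_rfl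
    fun τ ⟨hB, _, hsame, hpow⟩ => ⟨hB, hsame, hpow⟩
  · rintro c hc τ ⟨hB, hctr, hsame, hpow⟩
    have hn' := (hsame.reg 0 (by decide)).trans hn
    have hk' := (hsame.reg rDeg (by decide)).trans hk
    refine ⟨hB, by simp only [Expr.eval, hn', hk', hctr]; omega, ?_⟩
    refine Runs.store_seq (N := 1) (j := c + 1) (v := 2 ^ (c + 1)) hB
      (by simp only [Expr.eval, hctr]) (by simp only [Expr.eval, hctr, hpow c le_rfl, pow_succ])
      (Nat.pow_lt_pow_right one_lt_two (by omega)) fun hB => ?_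
    refine Runs.assign hB (v := c + 1) (by simp only [Expr.eval, Memory.setArr_reg, hctr])
      ⟨hB.setReg _ ((by omega : c + 1 ≤ L).trans_lt Nat.lt_two_pow_self), by simp,
        (hsame.setArr (by decide) _ _).setReg (by decide) _, fun m hm => ?_⟩
    rcases eq_or_ne m (c + 1) with rfl | hne
    · simp
    · simp [hne, hpow m (by omega)]
  · rintro τ ⟨hB, hctr, hsame, -⟩
    have hn' := (hsame.reg 0 (by decide)).trans hn
    have hk' := (hsame.reg rDeg (by decide)).trans hk
    exact ⟨hB, by simp only [Expr.eval, hn', hk', hctr, Nat.sub_self]⟩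

theorem runs_countTable (hB : Bounded L σ) (hmasks : σ.reg rMasks = 2 ^ k)
    (hctr : σ.reg rCtr = 0) (h0 : σ.arr aCount 0 = 0) :
    Runs L Code.countTable σ (2 ^ k * 3 + 1) fun τ => Bounded L τ ∧
      SameExcept [rCtr] [aCount] σ τ ∧ ∀ m < 2 ^ k, τ.arr aCount m = popCount m := by
  refine (Runs.loop (N := 2) (fun c τ => Bounded L τ ∧ τ.reg rCtr = c ∧
    SameExcept [rCtr] [aCount] σ τ ∧ τ.arr aCount 0 = 0 ∧ ∀ m < c, τ.arr aCount m = popCount m)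
    ?_ ?_ ⟨hB, hctr, .refl, h0, by simp⟩).mono le_rfl
    fun τ ⟨hB, _, hsame, _, hcount⟩ => ⟨hB, hsame, hcount⟩
  · rintro c hc τ ⟨hB, hctr, hsame, h0, hcount⟩
    have hmasks' := (hsame.reg rMasks (by decide)).trans hmasks
    have hlt := hmasks' ▸ hB.reg_lt rMasks
    have hhalf : τ.arr aCount (c / 2) = popCount (c / 2) := by
      rcases Nat.eq_zero_or_pos c with rfl | hpos
      · rw [Nat.zero_div, h0, popCount_zero]
      · exact hcount _ (Nat.div_lt_self hpos one_lt_two)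
    refine ⟨hB, by simp only [Expr.eval, hmasks', hctr]; omega, ?_⟩
    refine Runs.store_seq (N := 1) (j := c) (v := popCount c) hB hctr
      (by simp only [Expr.eval, Expr.eval_mod, hctr, hhalf, ← popCount_eq])
      ((popCount_le c).trans_lt (hc.trans hlt)) fun hB => ?_
    refine Runs.assign hB (v := c + 1) (by simp only [Expr.eval, Memory.setArr_reg, hctr])
      ⟨hB.setReg _ (hlt.trans_le' hc), by simp,
        (hsame.setArr (by decide) _ _).setReg (by decide) _, ?_, fun m hm => ?_⟩
    · rcases eq_or_ne 0 c with rfl | hne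
      · simp [popCount_zero]
      · simp [hne, h0]
    · rcases eq_or_ne m c with rfl | hne
      · simp
      · simp [hne, hcount m (by omega)]
  · rintro τ ⟨hB, hctr, hsame, -⟩
    have hmasks' := (hsame.reg rMasks (by decide)).trans hmasks
    exact ⟨hB, by simp only [Expr.eval, hmasks', hctr, Nat.sub_self]⟩

/-- The number of steps to set up the tables. -/
def tableSteps (n k r : ℕ) : ℕ :=
  1 + ((2 * n * r * k + k) * 3 + 1 + (1 + (1 + (2 ^ k * 3 + 1))))

theorem runs_tables (hB : Bounded L σ) (hn : σ.reg 0 = n) (hk : σ.reg rDeg = k)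
    (hctr : σ.reg rCtr = 0) (h0 : σ.arr aCount 0 = 0) (hL : 2 * n * r * k + k < L) :
    Runs L (Code.tables r) σ (tableSteps n k r) fun τ =>
      Bounded L τ ∧ SameExcept [rMasks, rCtr] [aPow, aCount] σ τ ∧ Tables n k r τ := by
  have hframe : SameExcept [rMasks, rCtr] [aPow, aCount] σ (σ.setArr aPow 0 1) :=
    SameExcept.refl.setArr (by decide) _ _
  refine Runs.store_seq hB (j := 0) (v := 1) rfl rfl
    (Nat.one_lt_two_pow (Nat.one_le_iff_ne_zero.1 hB.one_le)) fun hB => ?_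
  refine Runs.seq ((runs_powTable hB hn hk hctr (by simp) hL).mono le_rfl ?_)
  rintro τ ⟨hB, hpowSame, hpow⟩
  replace hframe := hframe.trans hpowSame
  have hkτ : τ.reg rDeg = k := (hframe.reg _ (by decide)).trans hk
  refine Runs.assign_seq hB (v := 2 ^ k)
    (by simp only [Expr.eval, hkτ, hpow k (Nat.le_add_left _ _)])
    (Nat.pow_lt_pow_right one_lt_two (by omega)) fun hB => ?_
  refine Runs.assign_seq hB (v := 0) rfl (by positivity) fun hB => ?_
  replace hframe := (hframe.setReg (x := rMasks) (by decide) (2 ^ k)).setReg (x := rCtr)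
    (by decide) 0
  refine (runs_countTable (k := k) hB (by simp) (by simp) ?_).mono le_rfl ?_
  · simpa [h0] using congrFun (hpowSame.arr aCount (by decide)) 0
  rintro ρ ⟨hB, hcountSame, hcount⟩
  refine ⟨hB, hframe.trans hcountSame, ?_, ?_, fun m hm => ?_, hcount⟩
  · simpa [hkτ] using hcountSame.reg rDeg (by decide)
  · simpa using hcountSame.reg rMasks (by decide)
  · simpa [hpow m hm] using congrFun (hcountSame.arr aPow (by decide)) m

theorem bounded_input (k : ℕ) (φ : Formula n) (hk : k < 2 ^ L)
    (hL : n + 2 * φ.nodes + 1 < 2 ^ L) : Bounded L (input k φ) where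
  one_le := by
    by_contra! hlt
    rw [Nat.lt_one_iff.1 hlt, pow_zero] at hL
    omega
  reg_lt x := by
    simp only [input, φ.length_encode]
    split_ifs <;> omega
  arr_lt a i := by
    simp only [input]
    split_ifs
    · by_cases hi : i < φ.encode.length
      · rw [List.getD_eq_getElem _ _ hi]
        have hle := φ.le_of_mem_encode _ (List.getElem_mem hi)
        omega
      · rw [List.getD_eq_default _ _ (not_lt.1 hi)]
        positivity
    · positivity

theorem Progress.initial (k r g : ℕ) (φ : Formula n) :
    Progress k r g φ 0 (Config.initial φ) where
  length := by rw [Config.initial, pendingCode_singleton, φ.length_encode, mul_zero, add_zero]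
  isPrefix := by rw [Config.initial, pendingCode_singleton]
  two_le := le_rfl
  fresh_le := le_rfl
  vertices := by simp [Config.initial]
  unused y hy := Pi.single_eq_of_ne (two_pos.trans_le hy).ne' _
  value_le y X := by
    rw [mul_zero, pow_zero]
    change (Pi.single 0 (Pi.single 0 1) : ℕ → ℕ → ℕ) y X ≤ 1
    rcases eq_or_ne y 0 with rfl | hy
    · rw [Pi.single_eq_same, Pi.single_apply]
      split_ifs <;> omega
    · rw [Pi.single_eq_of_ne hy]
      exact Nat.zero_le 1
  value := by simp [Config.initial, process]

theorem runs_initial (hF : Fits n k r φ.nodes g L) (hB : Bounded L σ) (hT : Tables n k r σ)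
    (hσ : SameExcept [rMasks, rCtr] [aPow, aCount] (input k φ) σ) :
    Runs L Code.initial σ 4 (Represents L k r φ 0 (Config.initial φ)) := by
  have hL : 2 < 2 ^ L := by linarith [hF.stack]
  have harr (a : ℕ) (ha : a ≠ 0) (ha' : a ∉ [aPow, aCount]) (j : ℕ) : σ.arr a j = 0 := by
    rw [hσ.arr a ha']
    exact if_neg ha
  have hvalues : HoldsValues k 0 σ := fun y X _ => harr aVal (by decide) (by decide) _
  refine Runs.store_seq (N := 3) hB (j := 0) (v := 1) rfl rfl (by omega) fun hB => ?_
  refine Runs.store_seq (N := 2) hB (j := 0) (v := 1) rfl rfl (by omega) fun hB => ?_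
  refine Runs.assign_seq (N := 1) hB (v := 1) rfl (by omega) fun hB => ?_
  have hframe : SameExcept [rTop, rFresh] [aVal, aSink] σ _ :=
    (((SameExcept.refl.setArr (a := aVal) (by decide) 0 1).setArr (a := aSink) (by decide)
      0 1).setReg (x := rTop) (by decide) 1).setReg (x := rFresh) (by decide) 2
  refine Runs.assign hB (v := 2) rfl
    ⟨hB.setReg _ hL, hT.of_sameExcept hframe, fun j => ?_, ?_, ⟨by simp [Config.initial], ?_⟩, ?_,
      by simp [Config.initial]⟩
  · rw [hframe.arr _ (by decide), hσ.arr _ (by decide)]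
    rfl
  · rw [hframe.reg _ (by decide), hσ.reg _ (by decide)]
    simp [input, φ.length_encode]
  · intro j p hj
    obtain ⟨rfl, rfl⟩ : j = 0 ∧ p = ⟨φ, 0, 1⟩ := by
      cases j <;> simp_all [Config.initial]
    simp [harr aSrc]
  · simpa [HoldsValues, Config.initial, Pi.single] using
      hvalues.add (v := 0) (Z := 0) (dim_pos k) 1

theorem runs_answer (hB : Bounded L σ) (hT : Tables n k r σ) (hV : HoldsValues k V σ) :
    Runs L Code.answer σ 2 fun τ => (V 1 (dim k - 1) < V 1 (dim k - 2) → τ.reg 0 = 1) ∧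
      (¬V 1 (dim k - 1) < V 1 (dim k - 2) → τ.reg 0 = 0) := by
  have hdim := dim_pos k
  have hread (d : ℕ) (hd : 0 < d) : σ.arr aVal (dim k + (dim k - d)) = V 1 (dim k - d) := by
    simpa only [one_mul] using hV 1 (dim k - d) (by omega)
  refine Runs.cond hB (fun hne => Runs.assign hB rfl ?_) fun h0 => Runs.assign hB rfl ?_
  · simp only [Expr.eval, eval_dim hT, hread 1 one_pos, hread 2 two_pos] at hne
    simp [Expr.eval, Nat.sub_ne_zero_iff_lt.1 hne]
  · simp only [Expr.eval, eval_dim hT, hread 1 one_pos, hread 2 two_pos] at h0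
    simp [Expr.eval, Nat.sub_eq_zero_iff_le.1 h0]

/-- The number of steps of the program on a formula with `N` nodes. -/
def stepBound (n k r N : ℕ) : ℕ :=
  tableSteps n k r + (4 + (N * (nodeSteps k r N + 1) + 1 + 2))

theorem runs_full (hF : Fits n k r φ.nodes g L) (hB : Bounded L (input k φ))
    (hL : 2 * n * r * k + k < L) :
    Runs L (Code.full r) (input k φ) (stepBound n k r φ.nodes) fun τ =>
      (HasQMonomial (r + 1) k φ.toPoly → τ.reg 0 = 1) ∧
      (¬HasQMonomial (r + 1) k φ.toPoly → τ.reg 0 = 0) := by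
  refine Runs.seq ((runs_tables (n := n) (k := k) hB (by simp [input]) (by simp [input])
    (by simp [input]) (by simp [input]) hL).mono le_rfl ?_)
  rintro σ ⟨hB, hsame, hT⟩
  refine Runs.seq ((runs_initial hF hB hT hsame).mono le_rfl fun σ hσ => Runs.seq ?_)
  refine (Runs.loop (N := nodeSteps k r φ.nodes)
    (fun i τ => ∃ c, Represents L k r φ i c τ ∧ Progress k r g φ i c) ?_ ?_
    ⟨_, hσ, Progress.initial k r g φ⟩).mono le_rfl ?_
  · rintro i hi τ ⟨c, h, hp⟩
    have hpos := h.position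
    exact ⟨h.bounded, by rw [Expr.eval]; omega, runs_node hF hi h hp⟩
  · rintro τ ⟨c, h, -⟩
    have hpos := h.position
    exact ⟨h.bounded, by rw [Expr.eval]; omega⟩
  · rintro τ ⟨c, h, hp⟩
    have hdone : c.tasks = [] := List.eq_nil_of_length_eq_zero (by linarith [hp.length_le])
    have hvalue := hp.value
    rw [hdone, process, List.foldr_nil] at hvalue
    rw [hasQMonomial_iff_states, ← hvalue]
    exact runs_answer h.bounded h.tables h.values

end RunsFull

/-! ### The running time -/

/-- A bound for the number of bits by which the values grow at a node. -/
def growthBound (n k r : ℕ) : ℕ := 2 * n * r * k + 4 * k + r + 2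

/-- A number of bits that suffices on a formula with `N` nodes. -/
def bitBound (n k r N : ℕ) : ℕ := (growthBound n k r + n + 4) * (N + 1)

theorem transitions_mul_le (n k r : ℕ) :
    transitions k r * 2 ^ (2 * n * r * k) ≤ 2 ^ (2 * n * r * k + 4 * k + r + 1) := by
  have hk : k ≤ 2 ^ k := Nat.lt_two_pow_self.le
  have hr : r ≤ 2 ^ r := Nat.lt_two_pow_self.le
  calc transitions k r * 2 ^ (2 * n * r * k)
      ≤ dim k * 2 ^ k * 2 ^ k * 2 ^ r * 2 ^ (2 * n * r * k) := by
        rw [transitions]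
        gcongr
    _ = 2 ^ (2 * n * r * k + 4 * k + r + 1) := by
        rw [dim]
        ring

section BitBound

variable (n k r N : ℕ)

theorem growthBound_mul_lt_bitBound : growthBound n k r * N < bitBound n k r N :=
  Nat.mul_lt_mul_of_le_of_lt (by omega) N.lt_succ_self (by omega)

theorem growthBound_le_bitBound : growthBound n k r + n + 4 ≤ bitBound n k r N :=
  Nat.le_mul_of_pos_right _ N.succ_pos

theorem lt_two_pow_bitBound : n + 2 * N + 3 < 2 ^ bitBound n k r N := by
  refine Nat.lt_two_pow_self.trans_le (Nat.pow_le_pow_right two_pos ?_)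
  rw [bitBound]
  nlinarith

theorem fits_bitBound : Fits n k r N (growthBound n k r) (bitBound n k r N) where
  growth := by
    have h := transitions_mul_le n k r
    have hone : 1 ≤ 2 ^ (2 * n * r * k + 4 * k + r + 1) := Nat.one_le_two_pow
    rw [growthBound, pow_succ _ (2 * n * r * k + 4 * k + r + 1)]
    omega
  values := growthBound_mul_lt_bitBound n k r N
  transitions_lt := by
    have hle : transitions k r ≤ transitions k r * 2 ^ (2 * n * r * k) :=
      Nat.le_mul_of_pos_right _ (by positivity)
    refine (hle.trans (transitions_mul_le n k r)).trans_lt (Nat.pow_lt_pow_right one_lt_two ?_)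
    have hlt := growthBound_le_bitBound n k r N
    rw [growthBound] at hlt
    omega
  stack := (lt_two_pow_bitBound n k r N).trans_le' (by omega)

end BitBound

section TimeBound

variable {n k N S : ℕ}

theorem bitBound_le (r : ℕ) (hS : 1 ≤ S) (hN : N ≤ 3 * (n + k + 1) * S) :
    bitBound n k r N ≤ 24 * (r + 1) * (n + k + 1) ^ 3 * S := by
  have hgrowth : growthBound n k r + n + 4 ≤ 6 * (r + 1) * (n + k + 1) ^ 2 := by
    rw [growthBound]
    ring_nf
    omega
  have hnodes : N + 1 ≤ 4 * (n + k + 1) * S := by nlinarith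
  calc bitBound n k r N ≤ (6 * (r + 1) * (n + k + 1) ^ 2) * (4 * (n + k + 1) * S) :=
        Nat.mul_le_mul hgrowth hnodes
    _ = 24 * (r + 1) * (n + k + 1) ^ 3 * S := by ring

theorem tableSteps_le (n k r : ℕ) :
    tableSteps n k r ≤ 8 * (r + 1) * (n + k + 1) ^ 2 * 4 ^ k := by
  have hpow : 2 ^ k ≤ 4 ^ k := Nat.pow_le_pow_left (by norm_num) k
  have hone : 1 ≤ 4 ^ k := Nat.one_le_pow _ _ (by norm_num)
  have hpoly : (2 * n * r * k + k) * 3 + 8 ≤ 8 * (r + 1) * (n + k + 1) ^ 2 := by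
    ring_nf
    omega
  calc tableSteps n k r ≤ ((2 * n * r * k + k) * 3 + 8) * 4 ^ k := by
        have hle := Nat.le_mul_of_pos_right ((2 * n * r * k + k) * 3) hone
        rw [tableSteps, add_mul _ 8]
        omega
    _ ≤ 8 * (r + 1) * (n + k + 1) ^ 2 * 4 ^ k := Nat.mul_le_mul_right _ hpoly

theorem transitions_le (n k r : ℕ) : transitions k r ≤ 2 * (r + 1) * (n + k + 1) ^ 2 * 4 ^ k :=
  calc transitions k r = 2 * r * k ^ 2 * 4 ^ k := by
        rw [transitions, dim, ← mul_pow]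
        ring
    _ ≤ 2 * (r + 1) * (n + k + 1) ^ 2 * 4 ^ k := by
        gcongr <;> omega

theorem nodeSteps_le (r : ℕ) (hS : 1 ≤ S) (hN : N ≤ 3 * (n + k + 1) * S) :
    nodeSteps k r N + 1 ≤ 55 * (r + 1) * (n + k + 1) ^ 2 * 4 ^ k * S := by
  have hone : 1 ≤ 4 ^ k := Nat.one_le_pow _ _ (by norm_num)
  have hz : n + k + 1 ≤ (r + 1) * (n + k + 1) ^ 2 * 4 ^ k :=
    calc n + k + 1 ≤ 1 * (n + k + 1) ^ 2 * 1 := by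
          rw [one_mul, mul_one]
          exact Nat.le_self_pow two_ne_zero _
      _ ≤ (r + 1) * (n + k + 1) ^ 2 * 4 ^ k := by
          gcongr
          omega
  calc nodeSteps k r N + 1 ≤ 17 + 4 * transitions k r + 10 * N := by
        rw [nodeSteps]
        omega
    _ ≤ 17 * (n + k + 1) * S + 4 * (transitions k r * S) + 10 * (3 * (n + k + 1) * S) := by
        gcongr
        · nlinarith
        · exact Nat.le_mul_of_pos_right _ hS
    _ = (47 * (n + k + 1) + 4 * transitions k r) * S := by ring
    _ ≤ (47 * ((r + 1) * (n + k + 1) ^ 2 * 4 ^ k) +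
          4 * (2 * (r + 1) * (n + k + 1) ^ 2 * 4 ^ k)) * S := by
        gcongr
        exact transitions_le n k r
    _ = 55 * (r + 1) * (n + k + 1) ^ 2 * 4 ^ k * S := by ring

theorem stepBound_le (r : ℕ) (hS : 1 ≤ S) (hN : N ≤ 3 * (n + k + 1) * S) :
    stepBound n k r N ≤ 180 * (r + 1) * (n + k + 1) ^ 3 * 4 ^ k * S ^ 2 := by
  have hone : 1 ≤ (r + 1) * (n + k + 1) ^ 2 * 4 ^ k := Nat.one_le_iff_ne_zero.2 (by positivity)
  have htable := tableSteps_le n k r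
  have hzS : 1 ≤ (n + k + 1) * S ^ 2 := Nat.one_le_iff_ne_zero.2 (by positivity)
  calc stepBound n k r N = tableSteps n k r + 7 + N * (nodeSteps k r N + 1) := by
        rw [stepBound]
        ring
    _ ≤ (15 * ((r + 1) * (n + k + 1) ^ 2 * 4 ^ k)) * ((n + k + 1) * S ^ 2) +
          3 * (n + k + 1) * S * (55 * (r + 1) * (n + k + 1) ^ 2 * 4 ^ k * S) := by
        refine Nat.add_le_add ?_ (Nat.mul_le_mul hN (nodeSteps_le r hS hN))
        exact (by linarith : _ ≤ _).trans (Nat.le_mul_of_pos_right _ hzS)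
    _ = 180 * (r + 1) * (n + k + 1) ^ 3 * 4 ^ k * S ^ 2 := by ring

end TimeBound

theorem exists_exec_full (r k : ℕ) {n : ℕ} {φ : Formula n} (hφ : φ.IsSimple) :
    ∃ (τ : Memory) (t : ℕ), Exec (Code.full r) (input k φ) τ t ∧
      (HasQMonomial (r + 1) k φ.toPoly → τ.reg 0 = 1) ∧
      (¬HasQMonomial (r + 1) k φ.toPoly → τ.reg 0 = 0) ∧
      t ≤ (Code.full r).weight * 103680 * (r + 1) ^ 3 * (n + k + 1) ^ 9 * 4 ^ k *
        (max φ.size 1) ^ 4 := by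
  have hS : 1 ≤ max φ.size 1 := le_max_right _ _
  have hN : φ.nodes ≤ 3 * (n + k + 1) * max φ.size 1 :=
    (φ.nodes_le_mul_max hφ).trans (Nat.mul_le_mul_right _ (by omega))
  have hgrowth : 2 * n * r * k + k < bitBound n k r φ.nodes := by
    have hle := growthBound_le_bitBound n k r φ.nodes
    rw [growthBound] at hle
    omega
  have hinput : Bounded (bitBound n k r φ.nodes) (input k φ) :=
    bounded_input k φ ((by omega : k < bitBound n k r φ.nodes).trans Nat.lt_two_pow_self)
      ((lt_two_pow_bitBound n k r φ.nodes).trans_le' (by omega))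
  obtain ⟨τ, t, hexec, ht, hyes, hno⟩ :=
    runs_full (fits_bitBound n k r φ.nodes) hinput hgrowth
  refine ⟨τ, t, hexec, hyes, hno, ht.trans ?_⟩
  calc _ ≤ (Code.full r).weight * (24 * (r + 1) * (n + k + 1) ^ 3 * max φ.size 1) ^ 2 *
          (180 * (r + 1) * (n + k + 1) ^ 3 * 4 ^ k * (max φ.size 1) ^ 2) := by
        gcongr
        exacts [bitBound_le r hS hN, stepBound_le r hS hN]
    _ = _ := by ring

end QMonomial

open QMonomial in
theorem theorem1_general (q : ℕ) (hq : 1 ≤ q) :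
    ∃ (P : Program) (C c : ℕ), ∀ (n k : ℕ) (φ : Formula n), φ.IsSimple →
      ∃ (τ : Memory) (t : ℕ), Exec P (input k φ) τ t ∧
        (HasQMonomial q k φ.toPoly → τ.reg 0 = 1) ∧
        (¬HasQMonomial q k φ.toPoly → τ.reg 0 = 0) ∧
        t ≤ C * (n + k + 1) ^ c * 4 ^ k * (max φ.size 1) ^ 4 := by
  obtain ⟨r, rfl⟩ := Nat.exists_eq_add_of_le' hq
  exact ⟨Code.full r, _, 9, fun n k φ hφ => exists_exec_full r k hφ⟩

theorem theorem1 (q : ℕ) (hq : 2 ≤ q) :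
    ∃ (P : QMonomial.Program) (C c : ℕ),
      ∀ (n k : ℕ) (φ : QMonomial.Formula n), φ.IsSimple →
        ∃ (τ : QMonomial.Memory) (t : ℕ),
          QMonomial.Exec P (QMonomial.input k φ) τ t ∧
          (QMonomial.HasQMonomial q k φ.toPoly → τ.reg 0 = 1) ∧
          (¬ QMonomial.HasQMonomial q k φ.toPoly → τ.reg 0 = 0) ∧
          (t : ℝ) ≤ C * ((n : ℝ) + k + 1) ^ c * (5.44 : ℝ) ^ k * (max φ.size 1 : ℕ) ^ 4 := by
  obtain ⟨P, C, c, h⟩ := theorem1_general q (by omega)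
  refine ⟨P, C, c, fun n k φ hφ => ?_⟩
  obtain ⟨τ, t, hexec, hyes, hno, ht⟩ := h n k φ hφ
  refine ⟨τ, t, hexec, hyes, hno, ?_⟩
  calc (t : ℝ) ≤ C * ((n : ℝ) + k + 1) ^ c * 4 ^ k * (max φ.size 1 : ℕ) ^ 4 := mod_cast ht
    _ ≤ _ := by gcongr; norm_num
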